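/- Let $c,d\ge 0$ and $g$ be integers. On the space of homogeneous polynomials of degree $c$ in $u,v,w$ whose coefficient of $w^c$ is $1$, let $W_{c,g,d}$ be the equiclassical family of equations of reduced complex curves $D=\{G=0\}\subset(\mathbb P^2)^\vee$ of degree $c$, genus $g=1-\chi(\mathcal O_{\widetilde D})$ (for irreducible $D$, the geometric genus) and class $d$ (the number of tangents of $D$ through a general point), where $\nu:\widetilde D\to D$ is the normalization. Let $W_{c,g,d}(\mathbb R)$ be its set of real members, and let $\Phi(G)=G(-1,-i,w)-w^c\in\mathbb C[w]_{\le c-1}\cong\mathbb R^{2c}$ be the focal map on $W_{c,g,d}(\mathbb R)$. For a reduced curve $D=\{G=0\}$ of degree $c$, let $Z^{\rm ec}\subset(\mathbb P^2)^\vee$ be the equiclassical scheme: its ideal $\mathcal I_{Z^{\rm ec}}$ consists of the germs whose restriction to $D$ lies in the integral closure of the Jacobian ideal of $D$, i.e. in the ideal of $\mathcal O_{\widetilde D}$ generated by the partial derivatives of $G$. Let $\mathcal A_D=\nu^*(\mathcal I_{Z^{\rm ec}}(c-1)\otimes\mathcal O_D)/\text{torsion}$ be the class adjoint line bundle and $\mathcal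 B_D=\mathcal A_D\otimes\nu^*\mathcal O_D(-1)$ the focal adjoint line bundle on $\widetilde D$. Let $W$ be an irreducible component of $W_{c,g,d}(\mathbb R)$ and let $G$ be a smooth point of $W$, with $D=\{G=0\}$. Assume that 1. (tangent-space description) the Zariski tangent space at $G$ of the complexification $W_{\mathbb C}$ is the space of all $H\in H^0(\mathcal I_{Z^{\rm ec}}(c))$ with zero $w^c$-coefficient; 2. (adjoint sequence) the sequence $0\to\mathcal O(-1)\xrightarrow{\,G\,}\mathcal I_{Z^{\rm ec}}(c-1)\to\nu_*\mathcal A_D\to 0$ is exact; 3. $Z^{\rm ec}$ is disjoint from $Y=\{u^2+v^2=0\}$. Then there is a unique $\mathbb R$-linear isomorphism from the kernel of $d\Phi_G:T_GW\to\mathbb C[w]_{\le c-1}$ onto the real part of $H^0(\widetilde D,\mathcal B_D)$ (the sections fixed by complex conjugation) that sends $H$ to the section $\sigma$ with $H|_D=(u^2+v^2)\,\sigma$. The space $H^0(\widetilde D,\mathcal B_D)$ is finite-dimensional, and $$\dim_{\mathbb R}\ker(d\Phi_G)=h^0(\widetilde D,\mathcal B_D).$$ If moreover $W$ has the expected dimension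 $c+d-g+1$, then $$\operatorname{rank}(d\Phi_G)=c+d-g+1-h^0(\widetilde D,\mathcal B_D).$$ -/

import Mathlib

noncomputable section

namespace FocalCurves

open MvPolynomial

/-! ## Plane curves, their rational sections and their normalization

The dual projective plane has homogeneous coordinates `u, v, w` (indices `0, 1, 2`); a curve
`D = {G = 0}` is given by a homogeneous polynomial `G`. -/

/-- The homogeneous coordinate ring `ℂ[u, v, w]` of the (dual) plane. -/
abbrev CPoly : Type := MvPolynomial (Fin 3) ℂ

/-- Closed points of the (dual) plane. -/
abbrev PlanePt : Type := Projectivization ℂ (Fin 3 → ℂ)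

/-- The homogeneous coordinate ring `ℂ[u, v, w] / (G)` of the curve `D = {G = 0}`. -/
abbrev CoordRing (G : CPoly) : Type := CPoly ⧸ Ideal.span {G}

/-- The total ring of fractions of `ℂ[u, v, w] / (G)`.  Its elements which are quotients of
homogeneous elements are the rational sections of the sheaves `𝒪_D(n)`. -/
abbrev RatRing (G : CPoly) : Type := FractionRing (CoordRing G)

/-- Restriction of a polynomial to the curve `D = {G = 0}`. -/
def restrict (G : CPoly) : CPoly →ₐ[ℂ] RatRing G :=
  (IsScalarTower.toAlgHom ℂ (CoordRing G) (RatRing G)).comp (Ideal.Quotient.mkₐ ℂ (Ideal.span {G}))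

/-- A polynomial restricts to zero on `D` exactly when it is a multiple of `G`. -/
theorem restrict_eq_zero_iff (G a : CPoly) : restrict G a = 0 ↔ G ∣ a := by
  have h : restrict G a
      = algebraMap (CoordRing G) (RatRing G) (Ideal.Quotient.mk (Ideal.span {G}) a) := rfl
  rw [h, IsFractionRing.to_map_eq_zero_iff, Ideal.Quotient.eq_zero_iff_mem,
    Ideal.mem_span_singleton]

/-- The set of closed points of the curve `D = {G = 0}`. -/
def curvePoints (G : CPoly) : Set PlanePt := {z | eval z.rep G = 0}

/-- `a` is homogeneous of degree `m`, for an integer `m` (so `a = 0` if `m < 0`). -/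
def HomogeneousZ (a : CPoly) (m : ℤ) : Prop := ∀ e ∈ a.support, ((Finsupp.degree e : ℕ) : ℤ) = m

theorem HomogeneousZ.add {a b : CPoly} {m : ℤ} (ha : HomogeneousZ a m) (hb : HomogeneousZ b m) :
    HomogeneousZ (a + b) m := by
  classical
  intro e he
  rcases Finset.mem_union.1 (support_add he) with h | h
  · exact ha e h
  · exact hb e h

theorem HomogeneousZ.mul {a b : CPoly} {m n : ℤ} (ha : HomogeneousZ a m)
    (hb : HomogeneousZ b n) : HomogeneousZ (a * b) (m + n) := by
  classical
  intro e he
  obtain ⟨x, hx, y, hy, rfl⟩ := Finset.mem_add.1 (support_mul a b he)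
  rw [map_add, Nat.cast_add, ha x hx, hb y hy]

theorem homogeneousZ_C (r : ℂ) : HomogeneousZ (C r) 0 := by
  intro e he
  have h : e ∈ ({0} : Finset (Fin 3 →₀ ℕ)) := support_monomial_subset he
  simp [Finset.mem_singleton.1 h]

/-- For a multiplicative set `M` of polynomials, the fractions `a / b` on `D` of degree `n` whose
denominator is homogeneous, lies in `M`, and is invertible in the total ring of fractions (that is,
vanishes on no component of `D`). -/
def fractionsWith (G : CPoly) (M : Submonoid CPoly) (n : ℤ) : Submodule ℂ (RatRing G) where
  carrier := {x | ∃ (m : ℤ) (a b : CPoly), HomogeneousZ a (n + m) ∧ HomogeneousZ b m ∧ b ∈ M ∧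
    IsUnit (restrict G b) ∧ x * restrict G b = restrict G a}
  zero_mem' := ⟨0, 0, 1, by intro e he; simp at he, by simpa using homogeneousZ_C 1, M.one_mem,
    by simp, by simp⟩
  add_mem' := by
    rintro x y ⟨m, a, b, ha, hb, hbM, hu, hx⟩ ⟨m', a', b', ha', hb', hbM', hu', hy⟩
    refine ⟨m + m', a * b' + a' * b, b * b', ?_, hb.mul hb', M.mul_mem hbM hbM', ?_, ?_⟩
    · refine HomogeneousZ.add ?_ ?_
      · have := ha.mul hb'
        rwa [add_assoc] at this
      · have := ha'.mul hb
        rwa [add_assoc, add_comm m' m] at this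
    · rw [map_mul]; exact hu.mul hu'
    · simp only [map_mul, map_add, ← hx, ← hy]; ring
  smul_mem' := by
    rintro r x ⟨m, a, b, ha, hb, hbM, hu, hx⟩
    refine ⟨m, C r * a, b, ?_, hb, hbM, hu, ?_⟩
    · have := (homogeneousZ_C r).mul ha
      rwa [zero_add] at this
    · rw [smul_mul_assoc, hx, ← smul_eq_C_mul, map_smul]

theorem one_mem_fractionsWith (G : CPoly) (M : Submonoid CPoly) :
    (1 : RatRing G) ∈ fractionsWith G M 0 :=
  ⟨0, 1, 1, by simpa using homogeneousZ_C 1, by simpa using homogeneousZ_C 1, M.one_mem,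
    by simp, by simp⟩

theorem mul_mem_fractionsWith (G : CPoly) (M : Submonoid CPoly) {x y : RatRing G} {n n' : ℤ}
    (hx : x ∈ fractionsWith G M n) (hy : y ∈ fractionsWith G M n') :
    x * y ∈ fractionsWith G M (n + n') := by
  obtain ⟨m, a, b, ha, hb, hbM, hu, hx⟩ := hx
  obtain ⟨m', a', b', ha', hb', hbM', hu', hy⟩ := hy
  refine ⟨m + m', a * a', b * b', ?_, hb.mul hb', M.mul_mem hbM hbM', ?_, ?_⟩
  · have := ha.mul ha'
    rwa [show n + m + (n' + m') = n + n' + (m + m') by ring] at this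
  · rw [map_mul]; exact hu.mul hu'
  · simp only [map_mul, ← hx, ← hy]; ring

/-- The polynomials that do not vanish at the point `z`. -/
def nonvanishing (z : PlanePt) : Submonoid CPoly where
  carrier := {b | eval z.rep b ≠ 0}
  one_mem' := by simp
  mul_mem' := by
    intro a b ha hb
    simpa using And.intro ha hb

/-- The rational sections of `𝒪_D(n)`; for `n = 0` this is the ring of rational functions on `D`
(the product of the function fields of the components). -/
def ratSections (G : CPoly) (n : ℤ) : Submodule ℂ (RatRing G) := fractionsWith G ⊤ n

/-- The stalk `𝒪_D(n)_z`: the rational sections of `𝒪_D(n)` that are regular at `z`. -/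
def curveStalk (G : CPoly) (z : PlanePt) (n : ℤ) : Submodule ℂ (RatRing G) :=
  fractionsWith G (nonvanishing z) n

/-- The ring of rational functions on `D`. -/
def ratFunctions (G : CPoly) : Subalgebra ℂ (RatRing G) :=
  (ratSections G 0).toSubalgebra (one_mem_fractionsWith G ⊤)
    (fun _ _ hx hy => by
      have h := mul_mem_fractionsWith G ⊤ hx hy
      rwa [add_zero] at h)

/-- The local ring `𝒪_{D,z}`: the rational functions on `D` that are regular at `z`. -/
def localRing (G : CPoly) (z : PlanePt) : Subalgebra ℂ (RatRing G) :=
  (curveStalk G z 0).toSubalgebra (one_mem_fractionsWith G (nonvanishing z))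
    (fun _ _ hx hy => by
      have h := mul_mem_fractionsWith G (nonvanishing z) hx hy
      rwa [add_zero] at h)

/-- The stalk `(ν_* 𝒪_D̃)_z` for the normalization `ν : D̃ → D`: the integral closure of `𝒪_{D,z}`
in the ring of rational functions on `D`.  As `ν` is finite, sheaves of modules on `D̃` (and their
global sections) are the same as sheaves of modules over `ν_* 𝒪_D̃` on `D`; they are described in
this way below, by their stalks over the points `z` of `D`. -/
def normRing (G : CPoly) (z : PlanePt) : Subalgebra ℂ (RatRing G) :=
  (integralClosure (localRing G z) (RatRing G)).restrictScalars ℂ ⊓ ratFunctions G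

/-- The stalk at `z` of (the push-forward of) `ν^* 𝒪_D(n)`. -/
def normStalk (G : CPoly) (z : PlanePt) (n : ℤ) : Submodule ℂ (RatRing G) :=
  Submodule.span ℂ {x | ∃ f ∈ normRing G z, ∃ s ∈ curveStalk G z n, x = f * s}

/-! ## Genus and class -/

/-- `H⁰(D̃, 𝒪_D̃)`. -/
def normFunctions (G : CPoly) : Submodule ℂ (RatRing G) :=
  ratSections G 0 ⊓ ⨅ z ∈ curvePoints G, (normRing G z).toSubmodule

/-- Families of rational functions indexed by the points of `D`, all but finitely many of which
are regular on the normalization over the point. -/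
def repartitions (G : CPoly) : Submodule ℂ (curvePoints G → RatRing G) where
  carrier := {r | (∀ z, r z ∈ ratSections G 0) ∧ {z | r z ∉ normRing G z.1}.Finite}
  zero_mem' := by
    refine ⟨fun z => Submodule.zero_mem _, ?_⟩
    have : {z : curvePoints G | (0 : curvePoints G → RatRing G) z ∉ normRing G z.1} = ∅ := by
      ext z; simp
    rw [this]; exact Set.finite_empty
  add_mem' := by
    rintro r s ⟨hr, hr'⟩ ⟨hs, hs'⟩
    refine ⟨fun z => Submodule.add_mem _ (hr z) (hs z), (hr'.union hs').subset ?_⟩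
    intro z hz
    by_contra hcon
    simp only [Set.mem_union, Set.mem_ofPred_eq, not_or, not_not] at hcon
    exact hz ((normRing G z.1).add_mem hcon.1 hcon.2)
  smul_mem' := by
    rintro t r ⟨hr, hr'⟩
    refine ⟨fun z => Submodule.smul_mem _ t (hr z), hr'.subset ?_⟩
    intro z hz hcon
    exact hz ((normRing G z.1).smul_mem hcon t)

/-- The repartitions which differ from one rational function by a repartition that is regular on
all of the normalization. -/
def trivialRepartitions (G : CPoly) : Submodule ℂ (curvePoints G → RatRing G) where
  carrier := {r | ∃ x ∈ ratSections G 0, ∀ z, r z - x ∈ normRing G z.1}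
  zero_mem' := ⟨0, Submodule.zero_mem _, fun z => by simp [(normRing G z.1).zero_mem]⟩
  add_mem' := by
    rintro r s ⟨x, hx, hr⟩ ⟨y, hy, hs⟩
    refine ⟨x + y, Submodule.add_mem _ hx hy, fun z => ?_⟩
    have h := (normRing G z.1).add_mem (hr z) (hs z)
    rwa [show (r z - x) + (s z - y) = (r + s) z - (x + y) by
      simp only [Pi.add_apply]; ring] at h
  smul_mem' := by
    rintro t r ⟨x, hx, hr⟩
    refine ⟨t • x, Submodule.smul_mem _ t hx, fun z => ?_⟩
    have h := (normRing G z.1).smul_mem (hr z) t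
    rwa [smul_sub] at h

/-- `H¹(D̃, 𝒪_D̃)`, as the cokernel of the map from the rational functions to their principal
parts. -/
abbrev H1Norm (G : CPoly) : Type :=
  repartitions G ⧸ (trivialRepartitions G).submoduleOf (repartitions G)

/-- The genus of the reduced curve `D`, i.e. the arithmetic genus `1 - χ(𝒪_D̃)` of its
normalization; for an irreducible curve `h⁰(𝒪_D̃) = 1`, and this is the geometric genus
`h¹(𝒪_D̃)`. -/
def genus (G : CPoly) : ℤ :=
  1 - (Module.finrank ℂ (normFunctions G) : ℤ) + (Module.finrank ℂ (H1Norm G) : ℤ)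

/-- The gradient of `G` at `z`: the coefficients of the tangent line at `z`, if nonzero. -/
def gradient (G : CPoly) (z : Fin 3 → ℂ) : Fin 3 → ℂ := fun i => eval z (pderiv i G)

/-- The tangents of `D` (at its smooth points) that pass through the point `P`. -/
def tangentsThrough (G : CPoly) (P : Fin 3 → ℂ) : Set (Projectivization ℂ (Fin 3 → ℂ)) :=
  {l | ∃ z ∈ curvePoints G, ∃ h : gradient G z.rep ≠ 0,
    l = Projectivization.mk ℂ (gradient G z.rep) h ∧ gradient G z.rep ⬝ᵥ P = 0}

/-- `D` has class `d`: through a general point there are exactly `d` tangents of `D`. -/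
def HasClass (G : CPoly) (d : ℕ) : Prop :=
  ∃ F : CPoly, F ≠ 0 ∧ ∀ P : Fin 3 → ℂ, eval P F ≠ 0 → (tangentsThrough G P).ncard = d

/-! ## The equiclassical scheme and the adjoint bundles -/

/-- The stalk at `z`, twisted by `n`, of the ideal sheaf of `𝒪_D̃` generated by the partial
derivatives of the equation `G` of degree `c`. -/
def jacobianStalk (c : ℕ) (G : CPoly) (z : PlanePt) (n : ℤ) : Submodule ℂ (RatRing G) :=
  Submodule.span ℂ {x | ∃ (i : Fin 3), ∃ y ∈ normStalk G z (n - ((c : ℤ) - 1)),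
    x = restrict G (pderiv i G) * y}

/-- The support of the equiclassical scheme `Z^ec` of `D`.  The ideal of `Z^ec` at a point `z` of
`D` is the preimage in `𝒪_{ℙ²,z}` of the integral closure in `𝒪_{D,z}` of the Jacobian ideal, that
is, it consists of the functions whose restriction to `D` lies in the ideal of `𝒪_D̃` generated
by the partial derivatives of `G`; off `D` it is the unit ideal. -/
def equiclassicalSupport (c : ℕ) (G : CPoly) : Set PlanePt :=
  {z | z ∈ curvePoints G ∧ (1 : RatRing G) ∉ jacobianStalk c G z 0}

/-- `H⁰(ℐ_{Z^ec}(k))`: the homogeneous polynomials of degree `k` whose germ at each point lies in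
the ideal of the equiclassical scheme `Z^ec` of `D = {G = 0}`. -/
def equiclassicalSections (c : ℕ) (G : CPoly) (k : ℕ) : Set CPoly :=
  {H | H.IsHomogeneous k ∧ ∀ z ∈ curvePoints G, restrict G H ∈ jacobianStalk c G z k}

/-- The image of the stalk `ℐ_{Z^ec}(n)_z` in the rational sections of `𝒪_D(n)`. -/
def equiclassicalStalk (c : ℕ) (G : CPoly) (z : PlanePt) (n : ℤ) : Submodule ℂ (RatRing G) :=
  curveStalk G z n ⊓ jacobianStalk c G z n

/-- The stalk over `z` of the class adjoint line bundle `𝒜_D` on `D̃`: the pull-back of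
`ℐ_{Z^ec}(c-1) ⊗ 𝒪_D` to the normalization modulo torsion, i.e. the `𝒪_D̃`-submodule generated by
`ℐ_{Z^ec}(c-1)` in the rational sections of `ν^* 𝒪_D(c-1)`. -/
def classAdjointStalk (c : ℕ) (G : CPoly) (z : PlanePt) : Submodule ℂ (RatRing G) :=
  Submodule.span ℂ
    {x | ∃ f ∈ normRing G z, ∃ s ∈ equiclassicalStalk c G z ((c : ℤ) - 1), x = f * s}

/-- The equiclassical adjoint sequence
`0 → 𝒪(-1) → ℐ_{Z^ec}(c-1) → ν_* 𝒜_D → 0` is exact.  Here the first map is multiplication by `G`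
and the second one is restriction to `D`; the kernel of the restriction consists of the multiples
of `G` (see `restrict_eq_zero_iff`), so the content is that its image is all of `ν_* 𝒜_D`. -/
def AdjointSequence (c : ℕ) (G : CPoly) : Prop :=
  ∀ z ∈ curvePoints G, equiclassicalStalk c G z ((c : ℤ) - 1) = classAdjointStalk c G z

/-- The stalk over `z` of the focal adjoint line bundle `ℬ_D = 𝒜_D ⊗ ν^* 𝒪_D(-1)`. -/
def focalAdjointStalk (c : ℕ) (G : CPoly) (z : PlanePt) : Submodule ℂ (RatRing G) :=
  Submodule.span ℂ {x | ∃ s ∈ classAdjointStalk c G z, ∃ t ∈ normStalk G z (-1), x = s * t}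

/-- `H⁰(D̃, ℬ_D)`. -/
def focalAdjointSections (c : ℕ) (G : CPoly) : Submodule ℂ (RatRing G) :=
  ratSections G ((c : ℤ) - 2) ⊓ ⨅ z ∈ curvePoints G, focalAdjointStalk c G z

/-! ## Real structure -/

/-- The complex polynomial with the same coefficients as a real one. -/
def cplx : MvPolynomial (Fin 3) ℝ →+* CPoly := map (algebraMap ℝ ℂ)

/-- Complex conjugation of the coefficients. -/
def conjPoly : CPoly ≃+* CPoly := mapEquiv (Fin 3) (starRingAut : ℂ ≃+* ℂ)

theorem conjPoly_cplx (G : MvPolynomial (Fin 3) ℝ) : conjPoly (cplx G) = cplx G := by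
  have h : (starRingEnd ℂ).comp (algebraMap ℝ ℂ) = algebraMap ℝ ℂ := by
    ext r; simp
  change map (starRingEnd ℂ) (map (algebraMap ℝ ℂ) G) = map (algebraMap ℝ ℂ) G
  rw [map_map, h]

/-- Complex conjugation on the homogeneous coordinate ring of a real curve. -/
def conjCoordRing (G : MvPolynomial (Fin 3) ℝ) : CoordRing (cplx G) ≃+* CoordRing (cplx G) :=
  Ideal.quotientEquiv _ _ conjPoly (by
    rw [Ideal.map_span, Set.image_singleton]
    change _ = Ideal.span {conjPoly (cplx G)}
    rw [conjPoly_cplx])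

/-- Complex conjugation on the total ring of fractions of a real curve. -/
def conjRatRing (G : MvPolynomial (Fin 3) ℝ) : RatRing (cplx G) ≃+* RatRing (cplx G) :=
  IsFractionRing.ringEquivOfRingEquiv (conjCoordRing G)

theorem conjRatRing_restrict (G : MvPolynomial (Fin 3) ℝ) (a : CPoly) :
    conjRatRing G (restrict (cplx G) a) = restrict (cplx G) (conjPoly a) := by
  change IsFractionRing.ringEquivOfRingEquiv (conjCoordRing G)
    (algebraMap (CoordRing (cplx G)) (RatRing (cplx G)) (Ideal.Quotient.mk _ a)) = _
  rw [IsFractionRing.ringEquivOfRingEquiv_algebraMap]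
  rfl

theorem real_smul_eq (G : CPoly) (r : ℝ) (y : RatRing G) : r • y = (r : ℂ) • y := by
  rw [Algebra.smul_def, Algebra.smul_def]
  congr 1

theorem conjRatRing_smul (G : MvPolynomial (Fin 3) ℝ) (r : ℝ) (x : RatRing (cplx G)) :
    conjRatRing G (r • x) = r • conjRatRing G x := by
  have key : ∀ y : RatRing (cplx G), r • y = restrict (cplx G) (C (r : ℂ)) * y := by
    intro y
    rw [real_smul_eq, Algebra.smul_def]
    congr 1
  rw [key, key, map_mul, conjRatRing_restrict]
  congr 2
  change map (starRingEnd ℂ) (C (r : ℂ)) = C (r : ℂ)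
  simp

/-- The real part of `H⁰(D̃, ℬ_D)` for a real curve `D`: the sections fixed by complex
conjugation. -/
def realFocalAdjointSections (c : ℕ) (G : MvPolynomial (Fin 3) ℝ) :
    Submodule ℝ (RatRing (cplx G)) where
  carrier := {x | x ∈ focalAdjointSections c (cplx G) ∧ conjRatRing G x = x}
  zero_mem' := ⟨Submodule.zero_mem _, map_zero _⟩
  add_mem' := by
    rintro x y ⟨hx, hx'⟩ ⟨hy, hy'⟩
    exact ⟨Submodule.add_mem _ hx hy, by rw [map_add, hx', hy']⟩
  smul_mem' := by
    rintro r x ⟨hx, hx'⟩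
    refine ⟨?_, by rw [conjRatRing_smul, hx']⟩
    rw [real_smul_eq]
    exact Submodule.smul_mem _ _ hx

/-! ## Equiclassical families and their tangent spaces

The coefficients of a polynomial in `u, v, w` are the coordinates on the space of curves; a
polynomial function of the coefficients is an element of `MvPolynomial (Fin 3 →₀ ℕ) K`, with one
variable for each monomial in `u, v, w`. -/

section Zariski

variable (K : Type) [Field K]

/-- The Zariski topology on the space of polynomials in `u, v, w`. -/
@[reducible] def zariskiTopology : TopologicalSpace (MvPolynomial (Fin 3) K) :=
  TopologicalSpace.generateFrom
    (Set.range fun F : MvPolynomial (Fin 3 →₀ ℕ) K => {G | eval (fun m => coeff m G) F ≠ 0})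

variable {K}

/-- The ideal of the polynomial functions of the coefficients that vanish on `A`. -/
def vanishingIdealOn (A : Set (MvPolynomial (Fin 3) K)) : Ideal (MvPolynomial (Fin 3 →₀ ℕ) K) :=
  ⨅ G ∈ A, RingHom.ker (eval fun m => coeff m G)

/-- The differential at `G` of a polynomial function `F` of the coefficients. -/
def differentialAt (F : MvPolynomial (Fin 3 →₀ ℕ) K) (G : MvPolynomial (Fin 3) K) :
    MvPolynomial (Fin 3) K →ₗ[K] K :=
  ∑ m ∈ F.vars, eval (fun m' => coeff m' G) (pderiv m F) • lcoeff K m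

/-- The Zariski tangent space at `G` of (the Zariski closure of) the set `A`. -/
def zariskiTangent (A : Set (MvPolynomial (Fin 3) K)) (G : MvPolynomial (Fin 3) K) :
    Submodule K (MvPolynomial (Fin 3) K) :=
  ⨅ F ∈ vanishingIdealOn A, LinearMap.ker (differentialAt F G)

/-- The dimension of `A`, i.e. the Krull dimension of the coordinate ring of its Zariski
closure. -/
def zariskiDim (A : Set (MvPolynomial (Fin 3) K)) : WithBot ℕ∞ :=
  ringKrullDim (MvPolynomial (Fin 3 →₀ ℕ) K ⧸ vanishingIdealOn A)

/-- `W` is an irreducible component of `A`. -/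
def IsComponent (W A : Set (MvPolynomial (Fin 3) K)) : Prop :=
  Maximal (fun B => B ⊆ A ∧ @IsIrreducible _ (zariskiTopology K) B) W

/-- `G` is a smooth point of `W`. -/
def IsSmoothPoint (W : Set (MvPolynomial (Fin 3) K)) (G : MvPolynomial (Fin 3) K) : Prop :=
  G ∈ W ∧ (Module.finrank K (zariskiTangent W G) : WithBot ℕ∞) = zariskiDim W

end Zariski

/-- The equiclassical family `W_{c,g,d}`: equations of reduced plane curves of degree `c`,
genus `g` and class `d`, on the affine chart where the coefficient of `w^c` is `1`. -/
def equiclassicalFamily (c : ℕ) (g : ℤ) (d : ℕ) : Set CPoly :=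
  {G | G.IsHomogeneous c ∧ coeff (Finsupp.single 2 c) G = 1 ∧ Squarefree G ∧ genus G = g ∧
    HasClass G d}

/-- The real equiclassical family `W_{c,g,d}(ℝ)`. -/
def realEquiclassicalFamily (c : ℕ) (g : ℤ) (d : ℕ) : Set (MvPolynomial (Fin 3) ℝ) :=
  {G | cplx G ∈ equiclassicalFamily c g d}

/-- The usual equiclassical tangent-space description at the point `G` of `W`: the Zariski
tangent space at `G` of the complexification of `W` consists of the sections of
`ℐ_{Z^ec}(c)` with zero `w^c`-coefficient. -/
def TangentSpaceDescription (c : ℕ) (W : Set (MvPolynomial (Fin 3) ℝ))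
    (G : MvPolynomial (Fin 3) ℝ) : Prop :=
  ∀ H : CPoly, H ∈ zariskiTangent (cplx '' W) (cplx G) ↔
    H ∈ equiclassicalSections c (cplx G) c ∧ coeff (Finsupp.single 2 c) H = 0

/-! ## The focal map -/

/-- The substitution `G ↦ G_+ = G(-1, -i, w)`. -/
def plusPart : MvPolynomial (Fin 3) ℝ →ₐ[ℝ] Polynomial ℂ :=
  aeval ![Polynomial.C (-1), Polynomial.C (-Complex.I), Polynomial.X]

/-- The focal map `Φ(G) = G_+(w) - w^c`. -/
def focalMap (c : ℕ) (G : MvPolynomial (Fin 3) ℝ) : Polynomial ℂ :=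
  plusPart G - Polynomial.X ^ c

/-- On the affine chart, the focal map takes values in the polynomials of degree at most `c - 1`. -/
theorem degree_focalMap_lt (c : ℕ) (G : MvPolynomial (Fin 3) ℝ) (hG : G.IsHomogeneous c)
    (h1 : coeff (Finsupp.single 2 c) G = 1) : (focalMap c G).degree < c := by
  have key : ∀ H : MvPolynomial (Fin 3) ℝ, H.IsHomogeneous c →
      coeff (Finsupp.single 2 c) H = 0 → plusPart H ∈ Polynomial.degreeLT ℂ c := by
    intro H hH h0
    rw [H.as_sum, map_sum]
    refine Submodule.sum_mem _ fun e he => ?_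
    have hd : e 0 + e 1 + e 2 = c := by
      have := hH (mem_support_iff.1 he)
      rw [Finsupp.weight_apply, Finsupp.sum_fintype _ _ (by simp)] at this
      simpa [Fin.sum_univ_three] using this
    have hlt : e 2 < c := by
      by_contra hcon
      have h : e = Finsupp.single 2 c := by
        ext i
        fin_cases i <;> simp <;> omega
      exact mem_support_iff.1 he (h ▸ h0)
    have hval : plusPart (monomial e (coeff e H)) = Polynomial.C
        (((coeff e H : ℝ) : ℂ) * ((-1) ^ e 0 * (-Complex.I) ^ e 1)) * Polynomial.X ^ e 2 := by
      unfold plusPart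
      rw [aeval_monomial, Finsupp.prod_fintype _ _ (by simp)]
      simp only [Fin.prod_univ_three, Matrix.cons_val_zero, Matrix.cons_val_one,
        Matrix.cons_val_two, Matrix.head_cons, Matrix.tail_cons,
        Polynomial.C_mul, Polynomial.C_pow]
      rw [show algebraMap ℝ (Polynomial ℂ) (coeff e H) = Polynomial.C ((coeff e H : ℝ) : ℂ) from rfl]
      ring
    rw [hval, Polynomial.mem_degreeLT]
    exact (Polynomial.degree_C_mul_X_pow_le _ _).trans_lt (by exact_mod_cast hlt)
  have hX : plusPart (X 2 ^ c) = Polynomial.X ^ c := by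
    simp [plusPart]
  have := key (G - X 2 ^ c) (hG.sub (isHomogeneous_X_pow 2 c)) (by
    rw [coeff_sub, h1, X_pow_eq_monomial]; simp)
  rwa [map_sub, hX, Polynomial.mem_degreeLT] at this

/-- The differential `dΦ_G` of the focal map on the tangent space `T_G W`. -/
def focalDifferential (W : Set (MvPolynomial (Fin 3) ℝ)) (G : MvPolynomial (Fin 3) ℝ) :
    zariskiTangent W G →ₗ[ℝ] Polynomial ℂ :=
  plusPart.toLinearMap.domRestrict (zariskiTangent W G)

/-- `Φ` is an affine map, and `focalDifferential` is its derivative. -/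
theorem focalMap_add_smul (c : ℕ) (W : Set (MvPolynomial (Fin 3) ℝ))
    (G : MvPolynomial (Fin 3) ℝ) (H : zariskiTangent W G) (t : ℝ) :
    focalMap c (G + t • (H : MvPolynomial (Fin 3) ℝ))
      = focalMap c G + t • focalDifferential W G H := by
  have h : focalDifferential W G H = plusPart (H : MvPolynomial (Fin 3) ℝ) := rfl
  rw [h]
  unfold focalMap
  rw [map_add, map_smul]
  ring

/-- The union `Y = {u² + v² = 0}` of the two conjugate isotropic lines. -/
def isotropicLines : Set PlanePt := {z | z.rep 0 ^ 2 + z.rep 1 ^ 2 = 0}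

/-- The equation `u² + v²` of `Y`. -/
def isotropicForm : CPoly := X 0 ^ 2 + X 1 ^ 2

end FocalCurves

end

noncomputable section
namespace FocalCurves
open MvPolynomial

/-! ## Division by a monic polynomial -/

/-! The differential of the focal map is H ↦ H(-1,-i,w). For homogeneous H it vanishes exactly when
H vanishes on the line u = -iv; a real H then vanishes on the conjugate line u = iv too, so the
kernel consists of the tangent vectors H = (u²+v²)K with deg K = c-2 (`plusPart_eq_zero_iff`). Since
Z^ec misses Y, the factor u²+v² is a unit along Z^ec, so H satisfies the equiclassical condition if
and only if K does (`restrict_mem_jacobianStalk_iff`), and K|_D is the section σ.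

Conversely, twisting the adjoint sequence by -1 identifies the stalks of ℬ_D with those of the image
of ℐ_{Z^ec}(c-2) (`focalAdjointStalk_eq`), so a section of ℬ_D is in particular a global section of
𝒪_D(c-2). Such a section is the restriction of a polynomial K: this is the surjectivity onto
H⁰(𝒪_D(n)) usually drawn from the vanishing of H¹ of line bundles on ℙ². Here it comes from the
regularity of u^N, v^N modulo G (`exists_restrict_of_forall_mem_curveStalk`). Then (u²+v²)K has no
w^c-term, so it is a tangent vector.

The normalization that w^c has coefficient 1 in G is used throughout. It makes G monic in w, so that
nonzero polynomials in u, v are non-zero-divisors on D and σ is determined by H; it keeps D away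
from (0:0:1); and it excludes nonzero multiples of G from the tangent space, which gives
injectivity.

Tangent space and sections are both compatible with complex conjugation, so the real statement
follows from the complex one, and the real part of H⁰(ℬ_D) has real dimension h⁰(ℬ_D). The rank is
then given by rank–nullity, as the tangent space at a smooth point has the dimension of W. -/

/-- The remainder modulo a monic g is S-linear, so r kills the remainder of a, whose coefficients
lie in a domain. -/
theorem monic_dvd_of_dvd_C_mul {S : Type*} [CommRing S] [IsDomain S] {g a : Polynomial S}
    (hg : g.Monic) {r : S} (hr : r ≠ 0) (h : g ∣ Polynomial.C r * a) : g ∣ a := by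
  rw [← Polynomial.modByMonic_eq_zero_iff_dvd hg] at h ⊢
  rw [← Polynomial.smul_eq_C_mul, Polynomial.smul_modByMonic] at h
  exact (smul_eq_zero.1 h).resolve_left hr

/-- Comparing remainders modulo g gives r·(a mod g) = p·(b mod g). By `hpr`, p divides each
coefficient of a mod g, and the quotient is a'. -/
theorem monic_exists_dvd_sub_C_mul {S : Type*} [CommRing S] {g a b : Polynomial S}
    (hg : g.Monic) {p r : S} (hpr : ∀ x, p ∣ r * x → p ∣ x)
    (h : g ∣ Polynomial.C r * a - Polynomial.C p * b) : ∃ a', g ∣ a - Polynomial.C p * a' := by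
  have h1 : r • (a %ₘ g) = p • (b %ₘ g) := by
    rw [← Polynomial.modByMonic_eq_zero_iff_dvd hg, Polynomial.sub_modByMonic,
      ← Polynomial.smul_eq_C_mul, ← Polynomial.smul_eq_C_mul, Polynomial.smul_modByMonic,
      Polynomial.smul_modByMonic, sub_eq_zero] at h
    exact h
  have h2 : Polynomial.C p ∣ a %ₘ g := by
    rw [Polynomial.C_dvd_iff_dvd_coeff]
    intro i
    refine hpr _ ⟨(b %ₘ g).coeff i, ?_⟩
    simpa using congrArg (fun f => Polynomial.coeff f i) h1
  obtain ⟨a', ha'⟩ := h2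
  refine ⟨a', a /ₘ g, ?_⟩
  rw [← ha', sub_eq_iff_eq_add, add_comm, Polynomial.modByMonic_add_div]

/-- Polynomials in `u, v, w` as polynomials in `w` over the polynomials in `v, u`. -/
def toPolyW : CPoly ≃ₐ[ℂ] Polynomial (MvPolynomial (Fin 2) ℂ) :=
  (renameEquiv ℂ (Equiv.swap (0 : Fin 3) 2)).trans (finSuccEquiv ℂ 2)

/-- `finSuccEquiv` singles out the variable of index 0, hence the swap of u and w. Afterwards u is
`X 1` and v is `X 0`. -/
theorem toPolyW_X_zero : toPolyW (X 0) = Polynomial.C (X 1) := by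
  have : (2 : Fin 3) = Fin.succ 1 := rfl
  simp only [toPolyW, AlgEquiv.trans_apply, renameEquiv_apply, rename_X, Equiv.swap_apply_left]
  rw [this, finSuccEquiv_X_succ]

theorem toPolyW_X_one : toPolyW (X 1) = Polynomial.C (X 0) := by
  have : (1 : Fin 3) = Fin.succ 0 := rfl
  simp only [toPolyW, AlgEquiv.trans_apply, renameEquiv_apply, rename_X]
  rw [Equiv.swap_apply_of_ne_of_ne (by decide) (by decide), this, finSuccEquiv_X_succ]

/-- Homogeneity bounds the degree in w by c and makes the coefficient of w^c a constant in u, v. -/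
theorem toPolyW_monic {G : CPoly} {c : ℕ} (hG : G.IsHomogeneous c)
    (h1 : coeff (Finsupp.single 2 c) G = 1) : (toPolyW G).Monic := by
  have hH : (rename (Equiv.swap (0 : Fin 3) 2) G).IsHomogeneous c := hG.rename_isHomogeneous
  have hc : coeff (Finsupp.single 0 c) (rename (Equiv.swap (0 : Fin 3) 2) G) = 1 := by
    rw [← h1, ← coeff_rename_mapDomain _ (Equiv.swap (0 : Fin 3) 2).injective G,
      Finsupp.mapDomain_single, Equiv.swap_apply_right]
  have hval : toPolyW G = finSuccEquiv ℂ 2 (rename (Equiv.swap (0 : Fin 3) 2) G) := rfl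
  rw [hval]
  refine Polynomial.monic_of_natDegree_le_of_coeff_eq_one c ?_ ?_
  · rw [natDegree_finSuccEquiv]
    exact (degreeOf_le_totalDegree _ _).trans hH.totalDegree_le
  · ext m
    rw [finSuccEquiv_coeff_coeff, coeff_one]
    split_ifs with hm
    · subst hm
      rw [← hc]
      congr 1
      ext i
      refine Fin.cases ?_ (fun j => ?_) i <;> simp
    · refine hH.coeff_eq_zero ?_
      intro hdeg
      apply hm
      rw [Finsupp.degree_eq_sum, Fin.sum_univ_succ] at hdeg
      simp at hdeg
      ext i
      fin_cases i
      · simpa using hdeg.1.symm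
      · simpa using hdeg.2.symm

/-! ### Non-zero-divisors and regular sequences modulo G -/

variable {G : CPoly} {c : ℕ}

/-- A nonzero polynomial in `u, v` is a non-zero-divisor modulo `G`. -/
theorem dvd_of_dvd_mul (hG : G.IsHomogeneous c) (h1 : coeff (Finsupp.single 2 c) G = 1)
    {p a : CPoly} {r : MvPolynomial (Fin 2) ℂ} (hp : toPolyW p = Polynomial.C r) (hr : r ≠ 0)
    (h : G ∣ p * a) : G ∣ a := by
  rw [← map_dvd_iff toPolyW] at h ⊢
  rw [map_mul, hp] at h
  exact monic_dvd_of_dvd_C_mul (toPolyW_monic hG h1) hr h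

/-- `u ^ N, v ^ N` is a regular sequence modulo `G`. -/
theorem exists_dvd_sub_X_pow_mul (hG : G.IsHomogeneous c)
    (h1 : coeff (Finsupp.single 2 c) G = 1) {a b : CPoly} {N : ℕ}
    (h : G ∣ X 1 ^ N * a - X 0 ^ N * b) : ∃ a', G ∣ a - X 0 ^ N * a' := by
  rw [← map_dvd_iff toPolyW] at h
  simp only [map_mul, map_sub, map_pow, toPolyW_X_zero, toPolyW_X_one] at h
  rw [← Polynomial.C_pow, ← Polynomial.C_pow] at h
  -- In these variables: if u^N divides v^N x then u^N divides x, because u is a prime not dividing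
  -- v.
  have hpr : ∀ x : MvPolynomial (Fin 2) ℂ, (X 1 ^ N : MvPolynomial (Fin 2) ℂ) ∣ X 0 ^ N * x →
      (X 1 ^ N : MvPolynomial (Fin 2) ℂ) ∣ x := by
    intro x hx
    refine (X_prime (R := ℂ) (i := (1 : Fin 2))).pow_dvd_of_dvd_mul_left N ?_ hx
    intro hd
    have := (X_prime (R := ℂ) (i := (1 : Fin 2))).dvd_of_dvd_pow hd
    rw [X_dvd_X] at this
    simp at this
  obtain ⟨a', ha'⟩ := monic_exists_dvd_sub_C_mul (toPolyW_monic hG h1) hpr h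
  refine ⟨toPolyW.symm a', ?_⟩
  rw [← map_dvd_iff toPolyW]
  simpa [toPolyW_X_zero] using ha'

theorem isUnit_restrict (hG : G.IsHomogeneous c) (h1 : coeff (Finsupp.single 2 c) G = 1)
    {p : CPoly} {r : MvPolynomial (Fin 2) ℂ} (hp : toPolyW p = Polynomial.C r) (hr : r ≠ 0) :
    IsUnit (restrict G p) := by
  refine IsLocalization.map_units (RatRing G)
    (⟨Ideal.Quotient.mk _ p, ?_⟩ : nonZeroDivisors (CoordRing G))
  rw [mem_nonZeroDivisors_iff_right]
  intro x hx
  obtain ⟨a, rfl⟩ := Ideal.Quotient.mk_surjective x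
  rw [← map_mul, Ideal.Quotient.eq_zero_iff_mem, Ideal.mem_span_singleton] at hx
  rw [Ideal.Quotient.eq_zero_iff_mem, Ideal.mem_span_singleton]
  exact dvd_of_dvd_mul hG h1 hp hr (by rwa [mul_comm])

theorem isUnit_restrict_X_zero (hG : G.IsHomogeneous c)
    (h1 : coeff (Finsupp.single 2 c) G = 1) : IsUnit (restrict G (X 0)) :=
  isUnit_restrict hG h1 toPolyW_X_zero (X_ne_zero _)

theorem isUnit_restrict_X_one (hG : G.IsHomogeneous c)
    (h1 : coeff (Finsupp.single 2 c) G = 1) : IsUnit (restrict G (X 1)) :=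
  isUnit_restrict hG h1 toPolyW_X_one (X_ne_zero _)

theorem isUnit_restrict_isotropicForm (hG : G.IsHomogeneous c)
    (h1 : coeff (Finsupp.single 2 c) G = 1) : IsUnit (restrict G isotropicForm) := by
  refine isUnit_restrict (r := X 1 ^ 2 + X 0 ^ 2) hG h1 ?_ ?_
  · simp [isotropicForm, toPolyW_X_zero, toPolyW_X_one]
  · intro h
    have := congrArg (eval ![1, 1]) h
    norm_num at this

/-! ## Homogeneity -/

attribute [local instance] MvPolynomial.gradedAlgebra

theorem homogeneousZ_natCast {a : CPoly} {n : ℕ} : HomogeneousZ a n ↔ a.IsHomogeneous n := by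
  constructor
  · intro h e he
    have := h e (mem_support_iff.2 he)
    rw [Finsupp.weight_apply]
    rw [Finsupp.degree_eq_sum] at this
    rw [Finsupp.sum_fintype _ _ (by simp)]
    have := Nat.cast_injective this
    simpa using this
  · intro h e he
    by_contra hne
    exact mem_support_iff.1 he (h.coeff_eq_zero fun h' => hne (by rw [h']))

theorem HomogeneousZ.eq_zero_of_neg {a : CPoly} {n : ℤ} (h : HomogeneousZ a n) (hn : n < 0) :
    a = 0 := by
  rw [← support_eq_empty, Finset.eq_empty_iff_forall_notMem]
  intro e he
  have := h e he
  omega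

theorem homogeneousZ_zero (n : ℤ) : HomogeneousZ 0 n := by
  intro e he; simp at he

theorem HomogeneousZ.nonneg {a : CPoly} {n : ℤ} (h : HomogeneousZ a n) (ha : a ≠ 0) : 0 ≤ n := by
  by_contra hn
  exact ha (h.eq_zero_of_neg (not_le.1 hn))

theorem homogeneousComponent_mul_of_isHomogeneous (a : CPoly) {b : CPoly} {m : ℕ}
    (hb : b.IsHomogeneous m) (k : ℕ) :
    homogeneousComponent (k + m) (a * b) = homogeneousComponent k a * b := by
  have := DirectSum.coe_decompose_mul_add_of_right_mem (homogeneousSubmodule (Fin 3) ℂ)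
    (i := k) (a := a) (hb : b ∈ homogeneousSubmodule (Fin 3) ℂ m)
  rw [← decomposition.decompose'_apply, ← decomposition.decompose'_apply]
  exact this

theorem homogeneousComponent_mul_of_isHomogeneous_of_lt (a : CPoly) {b : CPoly} {m : ℕ}
    (hb : b.IsHomogeneous m) {k : ℕ} (hk : k < m) :
    homogeneousComponent k (a * b) = 0 := by
  have := DirectSum.coe_decompose_mul_of_right_mem_of_not_le (homogeneousSubmodule (Fin 3) ℂ)
    (n := k) (a := a) (hb : b ∈ homogeneousSubmodule (Fin 3) ℂ m) (not_le.2 hk)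
  rw [← decomposition.decompose'_apply]
  exact this

theorem dvd_homogeneousComponent (hG : G.IsHomogeneous c) {f : CPoly} (h : G ∣ f) (k : ℕ) :
    G ∣ homogeneousComponent k f := by
  obtain ⟨a, rfl⟩ := h
  rw [mul_comm]
  rcases lt_or_ge k c with hk | hk
  · rw [homogeneousComponent_mul_of_isHomogeneous_of_lt a hG hk]
    exact dvd_zero _
  · obtain ⟨j, rfl⟩ := Nat.exists_eq_add_of_le' hk
    rw [homogeneousComponent_mul_of_isHomogeneous a hG]
    exact dvd_mul_left _ _

/-- A rational section of `𝒪_D(n)` which is the restriction of a polynomial is the restriction of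
a homogeneous polynomial of degree `n`. -/
theorem exists_homogeneousZ_of_mem_ratSections (hG : G.IsHomogeneous c) {n : ℤ} {σ : RatRing G}
    (hσ : σ ∈ ratSections G n) {a : CPoly} (ha : σ = restrict G a) :
    ∃ K, HomogeneousZ K n ∧ σ = restrict G K := by
  obtain ⟨m, a', b, ha', hb, -, hu, hx⟩ := hσ
  by_cases hb0 : b = 0
  · subst hb0
    -- If 0 is invertible the ring of fractions is zero, and K = 0 will do.
    rw [map_zero, isUnit_zero_iff] at hu
    refine ⟨0, homogeneousZ_zero n, ?_⟩
    rw [map_zero, ← mul_one σ, ← hu, mul_zero]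
  lift m to ℕ using hb.nonneg hb0
  rw [homogeneousZ_natCast] at hb
  have hdvd : G ∣ a * b - a' := by
    rw [← restrict_eq_zero_iff, map_sub, map_mul, ← ha, hx, sub_self]
  -- For n < 0 the numerator has degree n + m < m, where ab has no component; so G divides the
  -- numerator and σ = 0.
  rcases lt_or_ge n 0 with hn | hn
  · refine ⟨0, homogeneousZ_zero n, ?_⟩
    suffices h : restrict G a' = 0 by
      rw [h] at hx
      rw [map_zero, (hu.mul_left_eq_zero).1 hx]
    rcases lt_or_ge (n + m) 0 with hnm | hnm
    · rw [ha'.eq_zero_of_neg hnm, map_zero]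
    · obtain ⟨k, hk⟩ := Int.eq_ofNat_of_zero_le hnm
      rw [hk, homogeneousZ_natCast] at ha'
      have := dvd_homogeneousComponent hG hdvd k
      rw [map_sub, homogeneousComponent_mul_of_isHomogeneous_of_lt a hb (by omega),
        homogeneousComponent_eq_self ha', zero_sub, dvd_neg] at this
      rwa [restrict_eq_zero_iff]
  · lift n to ℕ using hn
    refine ⟨homogeneousComponent n a,
      homogeneousZ_natCast.2 (homogeneousComponent_isHomogeneous n a), ?_⟩
    rw [← Nat.cast_add, homogeneousZ_natCast] at ha'
    -- The degree n + m part of ab - a' shows that the degree n component of a already represents σ.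
    have := dvd_homogeneousComponent hG hdvd (n + m)
    rw [map_sub, homogeneousComponent_mul_of_isHomogeneous a hb,
      homogeneousComponent_eq_self ha', ← restrict_eq_zero_iff, map_sub, map_mul, ← hx,
      sub_eq_zero] at this
    exact (hu.mul_right_cancel this).symm

theorem eval_smul_of_isHomogeneous {b : CPoly} {m : ℕ} (hb : b.IsHomogeneous m) (t : ℂ)
    (x : Fin 3 → ℂ) : eval (t • x) b = t ^ m * eval x b := by
  rw [eval_eq', eval_eq', Finset.mul_sum]
  refine Finset.sum_congr rfl fun e he => ?_
  have hd : ∑ i, e i = m := by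
    have := hb (mem_support_iff.1 he)
    rw [Finsupp.weight_apply, Finsupp.sum_fintype _ _ (by simp)] at this
    simpa using this
  simp only [Pi.smul_apply, smul_eq_mul, mul_pow, Finset.prod_mul_distrib]
  rw [Finset.prod_pow_eq_pow_sum, hd]
  ring

/-- Points of the plane carry a chosen representative; this allows passage to any other vector on
the same line. -/
theorem HomogeneousZ.eval_smul_ne_zero {b : CPoly} {m : ℤ} (hb : HomogeneousZ b m)
    {x : Fin 3 → ℂ} {t : ℂ} (h : eval (t • x) b ≠ 0) : eval x b ≠ 0 := by
  have hb0 : b ≠ 0 := by rintro rfl; simp at h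
  lift m to ℕ using hb.nonneg hb0
  rw [homogeneousZ_natCast] at hb
  intro h0
  apply h
  rw [eval_smul_of_isHomogeneous hb, h0, mul_zero]

/-- `H⁰(D, 𝒪_D(n))` consists of restrictions of polynomials. -/
theorem exists_restrict_of_forall_mem_curveStalk (hG : G.IsHomogeneous c)
    (h1 : coeff (Finsupp.single 2 c) G = 1) {n : ℤ} {σ : RatRing G}
    (hσ : ∀ z ∈ curvePoints G, σ ∈ curveStalk G z n) : ∃ a, σ = restrict G a := by
  -- J is the ideal of denominators of σ: the b for which bσ is the restriction of a polynomial.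
  let J : Ideal CPoly :=
    { carrier := {b | ∃ a, σ * restrict G b = restrict G a}
      zero_mem' := ⟨0, by simp⟩
      add_mem' := by
        rintro b b' ⟨a, ha⟩ ⟨a', ha'⟩
        exact ⟨a + a', by rw [map_add, map_add, mul_add, ha, ha']⟩
      smul_mem' := by
        rintro r b ⟨a, ha⟩
        exact ⟨r * a, by rw [smul_eq_mul, map_mul, map_mul, ← ha]; ring⟩ }
  have hGJ : G ∈ J := ⟨0, by rw [(restrict_eq_zero_iff G G).2 dvd_rfl, mul_zero, map_zero]⟩
  -- A nonzero common zero of J would be a point of D, as G lies in J; but regularity of σ there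
  -- puts into J a denominator not vanishing at it.
  have hzero : ∀ x ∈ zeroLocus ℂ J, x = 0 := by
    intro x hx
    by_contra hx0
    obtain ⟨t, ht⟩ := Projectivization.exists_smul_eq_mk_rep ℂ x hx0
    have hz : Projectivization.mk ℂ x hx0 ∈ curvePoints G := by
      by_contra hz
      have hz' : eval (Projectivization.mk ℂ x hx0).rep G ≠ 0 := hz
      rw [← ht] at hz'
      exact (homogeneousZ_natCast.2 hG).eval_smul_ne_zero (t := (t : ℂ)) hz'
        (by simpa using hx G hGJ)
    obtain ⟨m, a, b, -, hb, hbz, -, hab⟩ := hσ _ hz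
    have hbz' : eval (Projectivization.mk ℂ x hx0).rep b ≠ 0 := hbz
    rw [← ht] at hbz'
    exact hb.eval_smul_ne_zero (t := (t : ℂ)) hbz' (by simpa using hx b ⟨a, hab⟩)
  -- By the Nullstellensatz, J contains powers of u and of v.
  have hrad : ∀ i : Fin 3, (X i : CPoly) ∈ J.radical := by
    intro i
    rw [← vanishingIdeal_zeroLocus_eq_radical (K := ℂ), mem_vanishingIdeal_iff]
    intro x hx
    rw [hzero x hx]
    simp
  obtain ⟨N, hN⟩ := hrad 0
  obtain ⟨N', hN'⟩ := hrad 1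
  obtain ⟨a, ha⟩ : (X 0 ^ (N + N') : CPoly) ∈ J := by
    rw [pow_add]; exact J.mul_mem_right _ hN
  obtain ⟨b, hb⟩ : (X 1 ^ (N + N') : CPoly) ∈ J := by
    rw [pow_add]; exact J.mul_mem_left _ hN'
  -- With M = N + N', u^M σ = a and v^M σ = b give v^M a = u^M b on D; regularity then makes a
  -- divisible by u^M modulo G, and σ is the quotient.
  obtain ⟨a', ha'⟩ := exists_dvd_sub_X_pow_mul hG h1 (a := a) (b := b) (N := N + N') (by
    rw [← restrict_eq_zero_iff, map_sub, map_mul, map_mul, ← ha, ← hb]; ring)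
  refine ⟨a', ?_⟩
  rw [← restrict_eq_zero_iff, map_sub, map_mul, ← ha, sub_eq_zero, mul_comm, map_pow] at ha'
  exact ((isUnit_restrict_X_zero hG h1).pow _).mul_left_cancel ha'

end FocalCurves

namespace FocalCurves
open MvPolynomial

/-! ## Stalks of the adjoint bundles -/

variable {G : CPoly} {c : ℕ} {z : PlanePt}

theorem restrict_mem_curveStalk {a : CPoly} {n : ℤ} (ha : HomogeneousZ a n) :
    restrict G a ∈ curveStalk G z n :=
  ⟨0, a, 1, by simpa using ha, by simpa using homogeneousZ_C 1, Submonoid.one_mem _,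
    by simp, by simp⟩

theorem restrict_mem_ratSections {a : CPoly} {n : ℤ} (ha : HomogeneousZ a n) :
    restrict G a ∈ ratSections G n :=
  ⟨0, a, 1, by simpa using ha, by simpa using homogeneousZ_C 1, Submonoid.one_mem _,
    by simp, by simp⟩

theorem mem_curveStalk_of_mul_eq {x : RatRing G} {a b : CPoly} {m n : ℤ}
    (ha : HomogeneousZ a (n + m)) (hb : HomogeneousZ b m) (hz : eval z.rep b ≠ 0)
    (hu : IsUnit (restrict G b)) (h : x * restrict G b = restrict G a) :
    x ∈ curveStalk G z n :=
  ⟨m, a, b, ha, hb, hz, hu, h⟩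

theorem mul_mem_normStalk {x y : RatRing G} {m n : ℤ} (hx : x ∈ curveStalk G z m)
    (hy : y ∈ normStalk G z n) : x * y ∈ normStalk G z (m + n) := by
  induction hy using Submodule.span_induction with
  | mem y hy =>
    obtain ⟨f, hf, s, hs, rfl⟩ := hy
    exact Submodule.subset_span
      ⟨f, hf, x * s, mul_mem_fractionsWith G _ hx hs, mul_left_comm _ _ _⟩
  | zero => rw [mul_zero]; exact Submodule.zero_mem _
  | add y y' _ _ h h' => rw [mul_add]; exact Submodule.add_mem _ h h'
  | smul r y _ h => rw [mul_smul_comm]; exact Submodule.smul_mem _ r h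

theorem mul_mem_jacobianStalk {x y : RatRing G} {m n : ℤ} (hx : x ∈ curveStalk G z m)
    (hy : y ∈ jacobianStalk c G z n) : x * y ∈ jacobianStalk c G z (m + n) := by
  induction hy using Submodule.span_induction with
  | mem y hy =>
    obtain ⟨i, y, hy, rfl⟩ := hy
    refine Submodule.subset_span ⟨i, x * y, ?_, mul_left_comm _ _ _⟩
    rw [add_sub_assoc]
    exact mul_mem_normStalk hx hy
  | zero => rw [mul_zero]; exact Submodule.zero_mem _
  | add y y' _ _ h h' => rw [mul_add]; exact Submodule.add_mem _ h h'
  | smul r y _ h => rw [mul_smul_comm]; exact Submodule.smul_mem _ r h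

theorem mul_mem_equiclassicalStalk {x y : RatRing G} {m n : ℤ} (hx : x ∈ curveStalk G z m)
    (hy : y ∈ equiclassicalStalk c G z n) : x * y ∈ equiclassicalStalk c G z (m + n) :=
  ⟨mul_mem_fractionsWith G _ hx hy.1, mul_mem_jacobianStalk hx hy.2⟩

theorem normRing_mul_mem_classAdjointStalk {f y : RatRing G} (hf : f ∈ normRing G z)
    (hy : y ∈ classAdjointStalk c G z) : f * y ∈ classAdjointStalk c G z := by
  induction hy using Submodule.span_induction with
  | mem y hy =>
    obtain ⟨f', hf', s, hs, rfl⟩ := hy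
    exact Submodule.subset_span
      ⟨f * f', (normRing G z).mul_mem hf hf', s, hs, (mul_assoc _ _ _).symm⟩
  | zero => rw [mul_zero]; exact Submodule.zero_mem _
  | add y y' _ _ h h' => rw [mul_add]; exact Submodule.add_mem _ h h'
  | smul r y _ h => rw [mul_smul_comm]; exact Submodule.smul_mem _ r h

/-- The adjoint sequence, twisted by `-1`. -/
theorem focalAdjointStalk_le (hadj : AdjointSequence c G) (hz : z ∈ curvePoints G) :
    focalAdjointStalk c G z ≤ equiclassicalStalk c G z ((c : ℤ) - 2) := by
  refine Submodule.span_le.2 ?_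
  rintro _ ⟨s, hs, t, ht, rfl⟩
  induction ht using Submodule.span_induction with
  | mem t ht =>
    obtain ⟨f, hf, s', hs', rfl⟩ := ht
    have h := normRing_mul_mem_classAdjointStalk hf hs
    -- The adjoint sequence says that the elements of 𝒜_D already come from ℐ_{Z^ec}(c-1) on D; the
    -- remaining factor s' is a section of 𝒪_D(-1) on D itself.
    rw [← hadj z hz] at h
    have h' := mul_mem_equiclassicalStalk hs' h
    rw [show (-1 : ℤ) + ((c : ℤ) - 1) = c - 2 by ring] at h'
    rwa [show s * (f * s') = s' * (f * s) by ring]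
  | zero => rw [mul_zero]; exact Submodule.zero_mem _
  | add y y' _ _ h h' => rw [mul_add]; exact Submodule.add_mem _ h h'
  | smul r y _ h => rw [mul_smul_comm]; exact Submodule.smul_mem _ r h

/-- At (0:0:1) only the term w^c of G survives, so D avoids this point. Hence u or v trivializes
𝒪_D(1) at each point of D. -/
theorem rep_ne_zero_of_mem_curvePoints (hG : G.IsHomogeneous c)
    (h1 : coeff (Finsupp.single 2 c) G = 1) (hz : z ∈ curvePoints G) :
    z.rep 0 ≠ 0 ∨ z.rep 1 ≠ 0 := by
  by_contra! h
  have hz2 : z.rep 2 ≠ 0 := by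
    intro h2
    apply z.rep_nonzero
    ext i
    fin_cases i
    · exact h.1
    · exact h.2
    · exact h2
  have hz' : eval z.rep G = 0 := hz
  rw [eval_eq', Finset.sum_eq_single (Finsupp.single 2 c)] at hz'
  · rw [h1, one_mul, Fin.prod_univ_three] at hz'
    simp at hz'
    exact hz2 hz'.1
  · intro e he hne
    suffices h' : e 0 ≠ 0 ∨ e 1 ≠ 0 by
      rw [Fin.prod_univ_three, h.1, h.2]
      rcases h' with h' | h' <;> simp [h']
    by_contra! h'
    apply hne
    have hd := hG (mem_support_iff.1 he)
    rw [Finsupp.weight_apply, Finsupp.sum_fintype _ _ (by simp), Fin.sum_univ_three, h'.1,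
      h'.2] at hd
    ext i
    fin_cases i
    · simpa using h'.1
    · simpa using h'.2
    · simpa using hd
  · intro hs
    rw [notMem_support_iff.1 hs, zero_mul]

/-- Write x = (ℓx)·ℓ⁻¹, where ℓ is whichever of u, v does not vanish at z. -/
theorem le_focalAdjointStalk (hG : G.IsHomogeneous c)
    (h1 : coeff (Finsupp.single 2 c) G = 1) (hz : z ∈ curvePoints G) :
    equiclassicalStalk c G z ((c : ℤ) - 2) ≤ focalAdjointStalk c G z := by
  intro x hx
  obtain ⟨i, hi, hu⟩ : ∃ i, z.rep i ≠ 0 ∧ IsUnit (restrict G (X i)) := by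
    rcases rep_ne_zero_of_mem_curvePoints hG h1 hz with h | h
    · exact ⟨0, h, isUnit_restrict_X_zero hG h1⟩
    · exact ⟨1, h, isUnit_restrict_X_one hG h1⟩
  have hX : HomogeneousZ (X i) 1 := homogeneousZ_natCast.2 (isHomogeneous_X ℂ i)
  obtain ⟨t, ht⟩ := hu.exists_left_inv
  refine Submodule.subset_span ⟨restrict G (X i) * x, ?_, t, ?_, ?_⟩
  · refine Submodule.subset_span ⟨1, (normRing G z).one_mem, _, ?_, (one_mul _).symm⟩
    have := mul_mem_equiclassicalStalk (restrict_mem_curveStalk hX) hx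
    rwa [show (1 : ℤ) + ((c : ℤ) - 2) = c - 1 by ring] at this
  · refine Submodule.subset_span ⟨1, (normRing G z).one_mem, t, ?_, (one_mul _).symm⟩
    refine mem_curveStalk_of_mul_eq (a := 1) (b := X i) (m := 1) ?_ hX (by simpa using hi) hu ?_
    · simpa using homogeneousZ_C 1
    · rw [ht, map_one]
  · rw [mul_right_comm, mul_comm _ t, ht, one_mul]

theorem focalAdjointStalk_eq (hG : G.IsHomogeneous c)
    (h1 : coeff (Finsupp.single 2 c) G = 1) (hadj : AdjointSequence c G)
    (hz : z ∈ curvePoints G) :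
    focalAdjointStalk c G z = equiclassicalStalk c G z ((c : ℤ) - 2) :=
  (focalAdjointStalk_le hadj hz).antisymm (le_focalAdjointStalk hG h1 hz)

theorem homogeneousZ_isotropicForm : HomogeneousZ isotropicForm 2 :=
  homogeneousZ_natCast.2 ((isHomogeneous_X_pow 0 2).add (isHomogeneous_X_pow 1 2))

/-- Division by `u ^ 2 + v ^ 2` does not change the equiclassical condition if `Z^ec` is disjoint
from `Y`. -/
theorem restrict_mem_jacobianStalk_iff (hG : G.IsHomogeneous c)
    (h1 : coeff (Finsupp.single 2 c) G = 1)
    (hdisj : Disjoint (equiclassicalSupport c G) isotropicLines) (hz : z ∈ curvePoints G)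
    {K : CPoly} {n : ℤ} (hK : HomogeneousZ K n) :
    restrict G (isotropicForm * K) ∈ jacobianStalk c G z (n + 2) ↔
      restrict G K ∈ jacobianStalk c G z n := by
  constructor
  · intro h
    by_cases hY : z ∈ isotropicLines
    · have hone : (1 : RatRing G) ∈ jacobianStalk c G z 0 := by
        by_contra h'
        exact Set.disjoint_left.1 hdisj ⟨hz, h'⟩ hY
      simpa using mul_mem_jacobianStalk (restrict_mem_curveStalk hK) hone
    · have hu := isUnit_restrict_isotropicForm hG h1
      obtain ⟨t, ht⟩ := hu.exists_left_inv
      have hev : eval z.rep isotropicForm ≠ 0 := by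
        intro h0
        apply hY
        change z.rep 0 ^ 2 + z.rep 1 ^ 2 = 0
        simpa [isotropicForm] using h0
      have htm : t ∈ curveStalk G z (-2) := by
        refine mem_curveStalk_of_mul_eq (a := 1) (m := 2) ?_ homogeneousZ_isotropicForm hev hu ?_
        · simpa using homogeneousZ_C 1
        · rw [ht, map_one]
      have := mul_mem_jacobianStalk htm h
      rwa [map_mul, ← mul_assoc, ht, one_mul, neg_add_cancel_comm_assoc] at this
  · intro h
    rw [map_mul, add_comm]
    exact mul_mem_jacobianStalk (restrict_mem_curveStalk homogeneousZ_isotropicForm) h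

/-- Restriction to `D` of the polynomials of degree `c - 2`: those in `H⁰(ℐ_{Z^ec}(c - 2))` give
sections of the focal adjoint line bundle. -/
theorem restrict_mem_focalAdjointSections_iff (hG : G.IsHomogeneous c)
    (h1 : coeff (Finsupp.single 2 c) G = 1) (hadj : AdjointSequence c G)
    (hdisj : Disjoint (equiclassicalSupport c G) isotropicLines)
    {K : CPoly} (hK : HomogeneousZ K ((c : ℤ) - 2)) :
    restrict G K ∈ focalAdjointSections c G ↔
      isotropicForm * K ∈ equiclassicalSections c G c := by
  have hqK : (isotropicForm * K).IsHomogeneous c := by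
    have := homogeneousZ_isotropicForm.mul hK
    rwa [add_sub_cancel, homogeneousZ_natCast] at this
  have key : restrict G K ∈ focalAdjointSections c G ↔
      ∀ z ∈ curvePoints G, restrict G K ∈ jacobianStalk c G z ((c : ℤ) - 2) := by
    simp only [focalAdjointSections, Submodule.mem_inf, Submodule.mem_iInf,
      restrict_mem_ratSections hK, true_and]
    refine forall₂_congr fun z hz => ?_
    rw [focalAdjointStalk_eq hG h1 hadj hz]
    exact ⟨fun h => h.2, fun h => ⟨restrict_mem_curveStalk hK, h⟩⟩
  rw [key]
  constructor
  · intro h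
    refine ⟨hqK, fun z hz => ?_⟩
    have := (restrict_mem_jacobianStalk_iff hG h1 hdisj hz hK).2 (h z hz)
    rwa [sub_add_cancel] at this
  · rintro ⟨-, h⟩ z hz
    rw [← restrict_mem_jacobianStalk_iff hG h1 hdisj hz hK, sub_add_cancel]
    exact h z hz

/-- All the sections of the focal adjoint line bundle are restrictions of polynomials. -/
theorem exists_restrict_of_mem_focalAdjointSections (hG : G.IsHomogeneous c)
    (h1 : coeff (Finsupp.single 2 c) G = 1) (hadj : AdjointSequence c G) {σ : RatRing G}
    (hσ : σ ∈ focalAdjointSections c G) :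
    ∃ K, HomogeneousZ K ((c : ℤ) - 2) ∧ σ = restrict G K := by
  obtain ⟨hr, hs⟩ := hσ
  simp only [Submodule.mem_iInf, SetLike.mem_coe] at hs
  obtain ⟨a, ha⟩ := exists_restrict_of_forall_mem_curveStalk (n := (c : ℤ) - 2) (σ := σ) hG h1
    fun z hz => (focalAdjointStalk_le hadj hz (hs z hz)).1
  exact exists_homogeneousZ_of_mem_ratSections hG hr ha

/-- A multiple of G of degree c is a constant multiple, and that constant is its w^c-coefficient. -/
theorem eq_zero_of_restrict_eq_zero (hG : G.IsHomogeneous c)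
    (h1 : coeff (Finsupp.single 2 c) G = 1) {H : CPoly} (hH : H.IsHomogeneous c)
    (h0 : coeff (Finsupp.single 2 c) H = 0) (h : restrict G H = 0) : H = 0 := by
  rw [restrict_eq_zero_iff] at h
  obtain ⟨a, rfl⟩ := h
  have hc := homogeneousComponent_mul_of_isHomogeneous a hG 0
  rw [zero_add, mul_comm, homogeneousComponent_eq_self hH, homogeneousComponent_zero] at hc
  rw [hc, coeff_C_mul, h1, mul_one] at h0
  rw [hc, h0, C_0, zero_mul]

end FocalCurves

namespace FocalCurves
open MvPolynomial

/-! ## Real and imaginary parts of polynomials -/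

/-- The variables are arbitrary because this serves both for equations of curves and for polynomial
functions of their coefficients. -/
theorem exists_eq_map_add_I_mul_map {τ : Type*} (F : MvPolynomial τ ℂ) :
    ∃ A B : MvPolynomial τ ℝ,
      F = map (algebraMap ℝ ℂ) A + C Complex.I * map (algebraMap ℝ ℂ) B := by
  induction F using MvPolynomial.induction_on with
  | C a =>
    refine ⟨C a.re, C a.im, ?_⟩
    rw [map_C, map_C, ← C_mul, ← C_add, mul_comm]
    exact congrArg C (Complex.re_add_im a).symm
  | add p q hp hq =>
    obtain ⟨A, B, rfl⟩ := hp
    obtain ⟨A', B', rfl⟩ := hq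
    exact ⟨A + A', B + B', by rw [map_add, map_add]; ring⟩
  | mul_X p i hp =>
    obtain ⟨A, B, rfl⟩ := hp
    exact ⟨A * X i, B * X i, by rw [map_mul, map_mul, map_X]; ring⟩

theorem exists_eq_cplx_add_I_mul_cplx (H : CPoly) :
    ∃ A B : MvPolynomial (Fin 3) ℝ, H = cplx A + C Complex.I * cplx B :=
  exists_eq_map_add_I_mul_map H

theorem cplx_injective : Function.Injective cplx :=
  map_injective _ (algebraMap ℝ ℂ).injective

theorem coeff_cplx (m : Fin 3 →₀ ℕ) (H : MvPolynomial (Fin 3) ℝ) :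
    coeff m (cplx H) = ((coeff m H : ℝ) : ℂ) :=
  coeff_map _ _ _

theorem conjPoly_C_I : conjPoly (C Complex.I) = -C Complex.I := by
  change map (starRingEnd ℂ) (C Complex.I) = _
  rw [map_C, Complex.conj_I, C_neg]

theorem conjPoly_isotropicForm : conjPoly isotropicForm = isotropicForm := by
  change map (starRingEnd ℂ) isotropicForm = _
  simp [isotropicForm]

/-! ## Zariski tangent spaces and complexification -/

section
variable {K : Type} [Field K]

theorem mem_vanishingIdealOn {A : Set (MvPolynomial (Fin 3) K)}
    {F : MvPolynomial (Fin 3 →₀ ℕ) K} :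
    F ∈ vanishingIdealOn A ↔ ∀ G ∈ A, eval (fun m => coeff m G) F = 0 := by
  simp [vanishingIdealOn, Submodule.mem_iInf, RingHom.mem_ker]

theorem mem_zariskiTangent {A : Set (MvPolynomial (Fin 3) K)} {G H : MvPolynomial (Fin 3) K} :
    H ∈ zariskiTangent A G ↔ ∀ F ∈ vanishingIdealOn A, differentialAt F G H = 0 := by
  simp [zariskiTangent, Submodule.mem_iInf]

/-- Summing over any finite set containing `F.vars` lets the differentials of different functions be
compared termwise. -/
theorem differentialAt_apply {F : MvPolynomial (Fin 3 →₀ ℕ) K} (G H : MvPolynomial (Fin 3) K)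
    {s : Finset (Fin 3 →₀ ℕ)} (hs : F.vars ⊆ s) :
    differentialAt F G H
      = ∑ m ∈ s, eval (fun m' => coeff m' G) (pderiv m F) * coeff m H := by
  rw [differentialAt, LinearMap.sum_apply]
  simp only [LinearMap.smul_apply, smul_eq_mul]
  refine Finset.sum_subset hs fun m _ hm => ?_
  rw [pderiv_eq_zero_of_notMem_vars hm, map_zero, zero_mul]

theorem differentialAt_add (F F' : MvPolynomial (Fin 3 →₀ ℕ) K) (G H : MvPolynomial (Fin 3) K) :
    differentialAt (F + F') G H = differentialAt F G H + differentialAt F' G H := by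
  classical
  rw [differentialAt_apply G H (vars_add_subset F F'),
    differentialAt_apply G H (Finset.subset_union_left (s₂ := F'.vars)),
    differentialAt_apply G H (Finset.subset_union_right (s₁ := F.vars)),
    ← Finset.sum_add_distrib]
  simp only [map_add, add_mul]

theorem differentialAt_C_mul (r : K) (F : MvPolynomial (Fin 3 →₀ ℕ) K)
    (G H : MvPolynomial (Fin 3) K) :
    differentialAt (C r * F) G H = r * differentialAt F G H := by
  classical
  rw [differentialAt_apply G H (Finset.subset_union_left (s₂ := F.vars)),
    differentialAt_apply G H (Finset.subset_union_right (s₁ := (C r * F).vars)),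
    Finset.mul_sum]
  simp only [pderiv_C_mul, map_mul, eval_C, mul_assoc]

end

theorem eval_coeff_cplx (F : MvPolynomial (Fin 3 →₀ ℕ) ℝ) (G : MvPolynomial (Fin 3) ℝ) :
    eval (fun m => coeff m (cplx G)) (map (algebraMap ℝ ℂ) F)
      = ((eval (fun m => coeff m G) F : ℝ) : ℂ) := by
  rw [funext fun m => coeff_cplx m G]
  exact (map_eval (algebraMap ℝ ℂ) _ F).symm

theorem differentialAt_map_cplx (F : MvPolynomial (Fin 3 →₀ ℕ) ℝ)
    (G H : MvPolynomial (Fin 3) ℝ) :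
    differentialAt (map (algebraMap ℝ ℂ) F) (cplx G) (cplx H)
      = (differentialAt F G H : ℂ) := by
  rw [differentialAt_apply _ _ (vars_map_of_injective F (algebraMap ℝ ℂ).injective).subset,
    differentialAt_apply _ _ subset_rfl, Complex.ofReal_sum]
  refine Finset.sum_congr rfl fun m _ => ?_
  rw [pderiv_map, eval_coeff_cplx, coeff_cplx, Complex.ofReal_mul]

theorem ofReal_add_I_mul_eq_zero {a b : ℝ} : (a : ℂ) + Complex.I * b = 0 ↔ a = 0 ∧ b = 0 := by
  rw [Complex.ext_iff]; simp

/-- At a point of W both F₁ and F₂ take real values, so F₁ + iF₂ vanishes only if both do. -/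
theorem mem_vanishingIdealOn_cplx {W : Set (MvPolynomial (Fin 3) ℝ)}
    {F₁ F₂ : MvPolynomial (Fin 3 →₀ ℕ) ℝ} :
    map (algebraMap ℝ ℂ) F₁ + C Complex.I * map (algebraMap ℝ ℂ) F₂ ∈
      vanishingIdealOn (cplx '' W) ↔ F₁ ∈ vanishingIdealOn W ∧ F₂ ∈ vanishingIdealOn W := by
  simp only [mem_vanishingIdealOn, Set.forall_mem_image, map_add, map_mul, eval_C,
    eval_coeff_cplx, ofReal_add_I_mul_eq_zero, ← forall₂_and]

/-- The Zariski tangent space of the complexification is the complexification of the real Zariski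
tangent space. -/
theorem cplx_add_I_mul_cplx_mem_zariskiTangent {W : Set (MvPolynomial (Fin 3) ℝ)}
    {G A B : MvPolynomial (Fin 3) ℝ} :
    cplx A + C Complex.I * cplx B ∈ zariskiTangent (cplx '' W) (cplx G) ↔
      A ∈ zariskiTangent W G ∧ B ∈ zariskiTangent W G := by
  have hd : ∀ F : MvPolynomial (Fin 3 →₀ ℕ) ℝ,
      differentialAt (map (algebraMap ℝ ℂ) F) (cplx G) (cplx A + C Complex.I * cplx B)
        = (differentialAt F G A : ℂ) + Complex.I * (differentialAt F G B : ℂ) := by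
    intro F
    rw [map_add, ← smul_eq_C_mul, map_smul, smul_eq_mul, differentialAt_map_cplx,
      differentialAt_map_cplx]
  constructor
  · intro h
    rw [mem_zariskiTangent] at h
    have key : ∀ F ∈ vanishingIdealOn W, differentialAt F G A = 0 ∧ differentialAt F G B = 0 := by
      intro F hF
      have hF' := (mem_vanishingIdealOn_cplx (F₂ := 0)).2 ⟨hF, Submodule.zero_mem _⟩
      rw [map_zero, mul_zero, add_zero] at hF'
      have := h _ hF'
      rwa [hd, ofReal_add_I_mul_eq_zero] at this
    exact ⟨mem_zariskiTangent.2 fun F hF => (key F hF).1,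
      mem_zariskiTangent.2 fun F hF => (key F hF).2⟩
  · rintro ⟨hA, hB⟩
    rw [mem_zariskiTangent] at hA hB ⊢
    intro F hF
    obtain ⟨F₁, F₂, rfl⟩ := exists_eq_map_add_I_mul_map F
    obtain ⟨h1, h2⟩ := mem_vanishingIdealOn_cplx.1 hF
    rw [differentialAt_add, differentialAt_C_mul, hd, hd, hA _ h1, hB _ h1, hA _ h2, hB _ h2]
    simp

theorem cplx_mem_zariskiTangent {W : Set (MvPolynomial (Fin 3) ℝ)}
    {G A : MvPolynomial (Fin 3) ℝ} :
    cplx A ∈ zariskiTangent (cplx '' W) (cplx G) ↔ A ∈ zariskiTangent W G := by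
  have := cplx_add_I_mul_cplx_mem_zariskiTangent (W := W) (G := G) (A := A) (B := 0)
  simpa using this

/-! ## The kernel of the focal differential -/

/-- The substitution u ↦ tv is the identity modulo u - tv. -/
theorem X_sub_C_mul_X_dvd {t : ℂ} {A : CPoly}
    (h : aeval ![C t * X 1, X 1, X 2] A = (0 : CPoly)) : (X 0 - C t * X 1 : CPoly) ∣ A := by
  rw [← Ideal.mem_span_singleton, ← Ideal.Quotient.eq_zero_iff_mem]
  have hhom : (Ideal.Quotient.mkₐ ℂ (Ideal.span {(X 0 - C t * X 1 : CPoly)})).comp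
      (aeval ![C t * X 1, X 1, X 2]) = Ideal.Quotient.mkₐ ℂ _ := by
    ext i
    fin_cases i
    · simp only [AlgHom.comp_apply, Ideal.Quotient.mkₐ_eq_mk]
      rw [Ideal.Quotient.eq, ← neg_mem_iff]
      simp
    · simp
    · simp
  have := DFunLike.congr_fun hhom A
  rw [AlgHom.comp_apply, h, map_zero] at this
  exact this.symm

theorem plusPart_eq_aeval_cplx (H : MvPolynomial (Fin 3) ℝ) :
    plusPart H = aeval ![Polynomial.C (-1), Polynomial.C (-Complex.I), Polynomial.X] (cplx H) :=
  (aeval_map_algebraMap ℂ _ H).symm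

/-- A polynomial which vanishes for `u = t v` is divisible by `u - t v`. -/
theorem X_sub_C_mul_X_dvd_of_eval {t : ℂ} {A : CPoly}
    (h : ∀ v w : ℂ, v ≠ 0 → eval ![t * v, v, w] A = 0) : (X 0 - C t * X 1 : CPoly) ∣ A := by
  apply X_sub_C_mul_X_dvd
  -- Nothing is assumed at v = 0; multiplying by v gives a polynomial vanishing everywhere, and v
  -- then cancels.
  have hz : (X 1 : CPoly) * aeval ![C t * X 1, X 1, X 2] A = 0 := by
    refine MvPolynomial.funext fun x => ?_
    rw [map_mul, eval_X, map_zero]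
    by_cases hx : x 1 = 0
    · rw [hx, zero_mul]
    · have : eval x (aeval ![C t * X 1, X 1, X 2] A : CPoly) = eval ![t * x 1, x 1, x 2] A := by
        rw [← coe_aeval_eq_eval, ← coe_aeval_eq_eval, RingHom.coe_coe, RingHom.coe_coe,
          ← AlgHom.comp_apply, comp_aeval]
        congr 2
        ext i
        fin_cases i <;> simp
      rw [this, h _ _ hx, mul_zero]
  exact (mul_eq_zero.1 hz).resolve_left (X_ne_zero _)

theorem isotropicForm_eq :
    isotropicForm = (X 0 - C (-Complex.I) * X 1) * (X 0 - C Complex.I * X 1) := by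
  have h : (C Complex.I : CPoly) * C Complex.I = -1 := by
    rw [← C_mul, Complex.I_mul_I, C_neg, C_1]
  rw [isotropicForm, C_neg]
  linear_combination (X 1 ^ 2 : CPoly) * h

/-- The point (-iv, v, w) is iv times (-1, -i, w/(iv)), so homogeneity carries the vanishing over.
-/
theorem eval_eq_zero_of_plusPart_eq_zero {c : ℕ} {H : MvPolynomial (Fin 3) ℝ}
    (hH : (cplx H).IsHomogeneous c) (h : plusPart H = 0) (v w : ℂ) (hv : v ≠ 0) :
    eval ![-Complex.I * v, v, w] (cplx H) = 0 := by
  have hx : ![-Complex.I * v, v, w]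
      = (Complex.I * v) • ![-1, -Complex.I, w / (Complex.I * v)] := by
    have hI : Complex.I * v ≠ 0 := mul_ne_zero Complex.I_ne_zero hv
    ext i
    fin_cases i
    · simp
    · simp only [Pi.smul_apply, smul_eq_mul]
      change v = Complex.I * v * -Complex.I
      linear_combination v * Complex.I_mul_I
    · simp only [Pi.smul_apply, smul_eq_mul]
      change w = Complex.I * v * (w / (Complex.I * v))
      rw [mul_div_cancel₀ _ hI]
  rw [hx, eval_smul_of_isHomogeneous hH]
  have := congrArg (Polynomial.aeval (w / (Complex.I * v))) h
  rw [plusPart_eq_aeval_cplx, ← AlgHom.comp_apply, comp_aeval, map_zero] at this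
  rw [← coe_aeval_eq_eval, RingHom.coe_coe, ← mul_zero ((Complex.I * v) ^ c), ← this]
  congr 3
  ext i
  fin_cases i <;> simp

theorem eval_conj_cplx (H : MvPolynomial (Fin 3) ℝ) (x : Fin 3 → ℂ) :
    eval (fun i => starRingEnd ℂ (x i)) (cplx H) = starRingEnd ℂ (eval x (cplx H)) := by
  conv_lhs => rw [← conjPoly_cplx]
  exact (map_eval (starRingEnd ℂ) x (cplx H)).symm

/-- `H(-1, -i, w) = 0` if and only if `u ^ 2 + v ^ 2` divides `H`. -/
theorem plusPart_eq_zero_iff {c : ℕ} {H : MvPolynomial (Fin 3) ℝ}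
    (hH : (cplx H).IsHomogeneous c) : plusPart H = 0 ↔ isotropicForm ∣ cplx H := by
  constructor
  · intro h
    have h0 := eval_eq_zero_of_plusPart_eq_zero hH h
    obtain ⟨A, hA⟩ := X_sub_C_mul_X_dvd_of_eval h0
    rw [isotropicForm_eq, hA]
    refine mul_dvd_mul_left _ (X_sub_C_mul_X_dvd_of_eval fun v w hv => ?_)
    -- H has real coefficients, so it also vanishes on the conjugate line u = iv.
    have h1 : eval ![Complex.I * v, v, w] (cplx H) = 0 := by
      have := eval_conj_cplx H ![-Complex.I * starRingEnd ℂ v, starRingEnd ℂ v, starRingEnd ℂ w]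
      rw [h0 _ _ (by simpa using hv), map_zero] at this
      rw [← this]
      congr 2
      ext i
      fin_cases i <;> simp
    rw [hA, map_mul] at h1
    -- On u = iv the factor u + iv equals 2iv, so it is the cofactor A that vanishes there.
    refine (mul_eq_zero.1 h1).resolve_left ?_
    simp only [map_sub, map_mul, eval_X, eval_C]
    change Complex.I * v - -Complex.I * v ≠ 0
    rw [show Complex.I * v - -Complex.I * v = 2 * Complex.I * v by ring]
    exact mul_ne_zero (mul_ne_zero two_ne_zero Complex.I_ne_zero) hv
  · rintro ⟨K, hK⟩
    rw [plusPart_eq_aeval_cplx, hK, map_mul]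
    have : aeval ![Polynomial.C (-1), Polynomial.C (-Complex.I), Polynomial.X] isotropicForm
        = (0 : Polynomial ℂ) := by
      simp only [isotropicForm, map_add, map_pow, aeval_X]
      change Polynomial.C (-1) ^ 2 + Polynomial.C (-Complex.I) ^ 2 = (0 : Polynomial ℂ)
      rw [← Polynomial.C_pow, ← Polynomial.C_pow, ← Polynomial.C_add]
      simp
    rw [this, zero_mul]

/-- The cofactor of `u ^ 2 + v ^ 2` in a homogeneous polynomial is homogeneous. -/
theorem exists_homogeneousZ_of_isotropicForm_dvd {c : ℕ} {H : CPoly} (hH : H.IsHomogeneous c)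
    (h : isotropicForm ∣ H) :
    ∃ K, HomogeneousZ K ((c : ℤ) - 2) ∧ H = isotropicForm * K := by
  obtain ⟨K, rfl⟩ := h
  have hq : isotropicForm.IsHomogeneous 2 := homogeneousZ_natCast.1 homogeneousZ_isotropicForm
  have hc := homogeneousComponent_eq_self hH
  rw [mul_comm] at hc
  rcases lt_or_ge c 2 with h2 | h2
  · rw [homogeneousComponent_mul_of_isHomogeneous_of_lt K hq h2] at hc
    exact ⟨0, homogeneousZ_zero _, by rw [mul_comm, ← hc, mul_zero]⟩
  · obtain ⟨k, rfl⟩ := Nat.exists_eq_add_of_le' h2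
    rw [homogeneousComponent_mul_of_isHomogeneous K hq] at hc
    refine ⟨homogeneousComponent k K, ?_, by rw [mul_comm, ← hc, mul_comm]⟩
    rw [show ((k + 2 : ℕ) : ℤ) - 2 = k by push_cast; ring, homogeneousZ_natCast]
    exact homogeneousComponent_isHomogeneous k K

theorem coeff_isotropicForm_mul (K : CPoly) (n : ℕ) :
    coeff (Finsupp.single 2 n) (isotropicForm * K) = 0 := by
  rw [isotropicForm, add_mul, coeff_add, pow_two, pow_two, mul_assoc, mul_assoc, coeff_X_mul',
    if_neg, zero_add, coeff_X_mul', if_neg]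
  all_goals
    intro h
    have := Finsupp.support_single_subset h
    simp at this

/-- Conjugation fixes u²+v², which therefore divides both A + iB and A - iB. -/
theorem isotropicForm_dvd_of_dvd_add_I_mul {A B : MvPolynomial (Fin 3) ℝ}
    (h : isotropicForm ∣ cplx A + C Complex.I * cplx B) :
    isotropicForm ∣ cplx A ∧ isotropicForm ∣ cplx B := by
  have h' : isotropicForm ∣ cplx A - C Complex.I * cplx B := by
    have := map_dvd conjPoly h
    rwa [map_add, map_mul, conjPoly_cplx, conjPoly_cplx, conjPoly_C_I, conjPoly_isotropicForm,
      neg_mul, ← sub_eq_add_neg] at this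
  have h2 : (C (1 / 2) : CPoly) * 2 = 1 := by
    rw [show (2 : CPoly) = C 2 from (map_ofNat C 2).symm, ← C_mul]; norm_num
  have hI : (C Complex.I : CPoly) * C Complex.I = -1 := by
    rw [← C_mul, Complex.I_mul_I, C_neg, C_1]
  constructor
  · have := (h.add h').mul_left (C (1 / 2))
    rwa [show C (1 / 2) * (cplx A + C Complex.I * cplx B + (cplx A - C Complex.I * cplx B))
      = cplx A by linear_combination cplx A * h2] at this
  · have := (dvd_sub h h').mul_left (-C Complex.I * C (1 / 2))
    rwa [show -C Complex.I * C (1 / 2) *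
      (cplx A + C Complex.I * cplx B - (cplx A - C Complex.I * cplx B)) = cplx B by
        linear_combination -(C (1 / 2) * 2 * cplx B) * hI + cplx B * h2] at this

end FocalCurves

namespace FocalCurves
open MvPolynomial

/-! ## The isomorphism of the kernel with the real focal adjoint sections -/

theorem conjRatRing_I_smul (G : MvPolynomial (Fin 3) ℝ) (x : RatRing (cplx G)) :
    conjRatRing G (Complex.I • x) = -(Complex.I • conjRatRing G x) := by
  have key : ∀ y : RatRing (cplx G), Complex.I • y = restrict (cplx G) (C Complex.I) * y := by
    intro y
    rw [Algebra.smul_def]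
    congr 1
  rw [key, key, map_mul, conjRatRing_restrict, conjPoly_C_I, map_neg, neg_mul]

theorem eq_zero_of_add_self_eq_zero {G : CPoly} {x : RatRing G} (h : x + x = 0) : x = 0 := by
  rw [← two_smul ℂ] at h
  exact (smul_eq_zero.1 h).resolve_left two_ne_zero

theorem I_smul_eq_zero {G : CPoly} {x : RatRing G} (h : Complex.I • x = 0) : x = 0 :=
  (smul_eq_zero.1 h).resolve_left Complex.I_ne_zero

/-- Real and imaginary parts are unique on the elements fixed by conjugation. -/
theorem eq_zero_of_add_I_smul_eq_zero {G : MvPolynomial (Fin 3) ℝ} {x y : RatRing (cplx G)}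
    (hx : conjRatRing G x = x) (hy : conjRatRing G y = y) (h : x + Complex.I • y = 0) :
    x = 0 ∧ y = 0 := by
  have h' := congrArg (conjRatRing G) h
  rw [map_add, conjRatRing_I_smul, hx, hy, map_zero] at h'
  have h0 : x = 0 := by
    apply eq_zero_of_add_self_eq_zero
    calc x + x = (x + Complex.I • y) + (x + -(Complex.I • y)) := by abel
      _ = 0 := by rw [h, h', add_zero]
  rw [h0, zero_add] at h
  exact ⟨h0, I_smul_eq_zero h⟩

theorem restrict_cplx_smul (G : CPoly) (r : ℝ) (H : MvPolynomial (Fin 3) ℝ) :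
    restrict G (cplx (r • H)) = r • restrict G (cplx H) := by
  have : cplx (r • H) = (r : ℂ) • cplx H := by
    rw [smul_eq_C_mul, smul_eq_C_mul, map_mul]
    congr 1
    exact map_C _ _
  rw [this, map_smul, real_smul_eq]

section
variable {c : ℕ} {W : Set (MvPolynomial (Fin 3) ℝ)} {G : MvPolynomial (Fin 3) ℝ}

/-- The map `H ↦ H / (u ^ 2 + v ^ 2)` on the kernel of the differential of the focal map, where
`t` is the inverse of `u ^ 2 + v ^ 2` on `D`. -/
def divIsotropicForm (W : Set (MvPolynomial (Fin 3) ℝ)) (G : MvPolynomial (Fin 3) ℝ)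
    (t : RatRing (cplx G)) :
    LinearMap.ker (focalDifferential W G) →ₗ[ℝ] RatRing (cplx G) where
  toFun H := t * restrict (cplx G) (cplx H.1.1)
  map_add' H H' := by
    change t * restrict (cplx G) (cplx (H.1.1 + H'.1.1)) = _
    rw [map_add, map_add, mul_add]
  map_smul' r H := by
    change t * restrict (cplx G) (cplx (r • H.1.1)) = r • (t * _)
    rw [restrict_cplx_smul, real_smul_eq, real_smul_eq, mul_smul_comm]

theorem restrict_cplx_eq_mul_divIsotropicForm {t : RatRing (cplx G)}
    (ht : t * restrict (cplx G) isotropicForm = 1)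
    (H : LinearMap.ker (focalDifferential W G)) :
    restrict (cplx G) (cplx H.1.1)
      = restrict (cplx G) isotropicForm * divIsotropicForm W G t H := by
  change _ = _ * (t * _)
  rw [← mul_assoc, mul_comm _ t, ht, one_mul]

theorem mem_zariskiTangent_iff (htan : TangentSpaceDescription c W G)
    {H : MvPolynomial (Fin 3) ℝ} : H ∈ zariskiTangent W G ↔
      cplx H ∈ equiclassicalSections c (cplx G) c ∧ coeff (Finsupp.single 2 c) (cplx H) = 0 := by
  rw [← htan, cplx_mem_zariskiTangent]

theorem divIsotropicForm_injective (hG : (cplx G).IsHomogeneous c)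
    (h1 : coeff (Finsupp.single 2 c) (cplx G) = 1) (htan : TangentSpaceDescription c W G)
    {t : RatRing (cplx G)} (ht : t * restrict (cplx G) isotropicForm = 1) :
    Function.Injective (divIsotropicForm W G t) := by
  rw [injective_iff_map_eq_zero]
  intro H hH
  obtain ⟨hs, h0⟩ := (mem_zariskiTangent_iff htan).1 H.1.2
  have hr := restrict_cplx_eq_mul_divIsotropicForm ht H
  rw [hH, mul_zero] at hr
  have := eq_zero_of_restrict_eq_zero hG h1 hs.1 h0 hr
  rw [← map_zero cplx] at this
  exact Subtype.ext (Subtype.ext (cplx_injective this))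

theorem divIsotropicForm_mem (hG : (cplx G).IsHomogeneous c)
    (h1 : coeff (Finsupp.single 2 c) (cplx G) = 1) (htan : TangentSpaceDescription c W G)
    (hadj : AdjointSequence c (cplx G))
    (hdisj : Disjoint (equiclassicalSupport c (cplx G)) isotropicLines)
    {t : RatRing (cplx G)} (ht : t * restrict (cplx G) isotropicForm = 1)
    (H : LinearMap.ker (focalDifferential W G)) :
    divIsotropicForm W G t H ∈ realFocalAdjointSections c G := by
  obtain ⟨hs, -⟩ := (mem_zariskiTangent_iff htan).1 H.1.2
  have hr := restrict_cplx_eq_mul_divIsotropicForm ht H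
  have hker : plusPart H.1.1 = 0 := H.2
  rw [plusPart_eq_zero_iff hs.1] at hker
  obtain ⟨K, hK, hHK⟩ := exists_homogeneousZ_of_isotropicForm_dvd hs.1 hker
  have hu := isUnit_restrict_isotropicForm hG h1
  constructor
  · have hKe : divIsotropicForm W G t H = restrict (cplx G) K := by
      apply hu.mul_left_cancel
      rw [← hr, hHK, map_mul]
    change _ ∈ focalAdjointSections c (cplx G)
    rw [hKe, restrict_mem_focalAdjointSections_iff hG h1 hadj hdisj hK, ← hHK]
    exact hs
  -- Both H and u²+v² are fixed by conjugation, hence so is their quotient.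
  · apply hu.mul_left_cancel
    rw [← hr]
    have := congrArg (conjRatRing G) hr
    rw [map_mul, conjRatRing_restrict, conjRatRing_restrict, conjPoly_cplx,
      conjPoly_isotropicForm] at this
    exact this.symm

/-- The sections of the focal adjoint line bundle are the complex combinations of the quotients by
`u ^ 2 + v ^ 2` of the elements of the kernel of the focal differential. -/
theorem exists_eq_divIsotropicForm_add_I_smul (hG : (cplx G).IsHomogeneous c)
    (h1 : coeff (Finsupp.single 2 c) (cplx G) = 1) (htan : TangentSpaceDescription c W G)
    (hadj : AdjointSequence c (cplx G))
    (hdisj : Disjoint (equiclassicalSupport c (cplx G)) isotropicLines)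
    {t : RatRing (cplx G)} (ht : t * restrict (cplx G) isotropicForm = 1)
    {σ : RatRing (cplx G)} (hσ : σ ∈ focalAdjointSections c (cplx G)) :
    ∃ A B, σ = divIsotropicForm W G t A + Complex.I • divIsotropicForm W G t B := by
  obtain ⟨K, hK, rfl⟩ := exists_restrict_of_mem_focalAdjointSections hG h1 hadj hσ
  rw [restrict_mem_focalAdjointSections_iff hG h1 hadj hdisj hK] at hσ
  have hT := (htan _).2 ⟨hσ, coeff_isotropicForm_mul K c⟩
  obtain ⟨A, B, hAB⟩ := exists_eq_cplx_add_I_mul_cplx (isotropicForm * K)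
  rw [hAB, cplx_add_I_mul_cplx_mem_zariskiTangent] at hT
  obtain ⟨hA, hB⟩ := isotropicForm_dvd_of_dvd_add_I_mul (Dvd.intro K hAB)
  have hA' := ((mem_zariskiTangent_iff htan).1 hT.1).1.1
  have hB' := ((mem_zariskiTangent_iff htan).1 hT.2).1.1
  refine ⟨⟨⟨A, hT.1⟩, (plusPart_eq_zero_iff hA').2 hA⟩,
    ⟨⟨B, hT.2⟩, (plusPart_eq_zero_iff hB').2 hB⟩, ?_⟩
  change _ = t * restrict (cplx G) (cplx A) + Complex.I • (t * restrict (cplx G) (cplx B))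
  rw [← mul_smul_comm, ← map_smul, smul_eq_C_mul, ← mul_add, ← map_add, ← hAB, map_mul,
    ← mul_assoc, ht, one_mul]

/-- The isomorphism of the kernel of the focal differential with the real part of
`H⁰(D̃, ℬ_D)`. -/
def kerFocalDifferentialEquiv (hG : (cplx G).IsHomogeneous c)
    (h1 : coeff (Finsupp.single 2 c) (cplx G) = 1) (htan : TangentSpaceDescription c W G)
    (hadj : AdjointSequence c (cplx G))
    (hdisj : Disjoint (equiclassicalSupport c (cplx G)) isotropicLines)
    {t : RatRing (cplx G)} (ht : t * restrict (cplx G) isotropicForm = 1) :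
    LinearMap.ker (focalDifferential W G) ≃ₗ[ℝ] realFocalAdjointSections c G :=
  LinearEquiv.ofBijective
    ((divIsotropicForm W G t).codRestrict (realFocalAdjointSections c G)
      (divIsotropicForm_mem hG h1 htan hadj hdisj ht)) (by
    constructor
    · intro H H' h
      exact divIsotropicForm_injective hG h1 htan ht (congrArg Subtype.val h)
    · rintro ⟨σ, hσ, hσ'⟩
      obtain ⟨A, B, rfl⟩ := exists_eq_divIsotropicForm_add_I_smul hG h1 htan hadj hdisj ht hσ
      have hA := (divIsotropicForm_mem hG h1 htan hadj hdisj ht A).2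
      have hB := (divIsotropicForm_mem hG h1 htan hadj hdisj ht B).2
      -- Conjugation negates the part multiplied by i, so it vanishes for a section fixed by
      -- conjugation.
      have hB0 : Complex.I • divIsotropicForm W G t B = 0 := by
        rw [map_add, conjRatRing_I_smul, hA, hB, add_left_cancel_iff, neg_eq_iff_add_eq_zero] at hσ'
        exact eq_zero_of_add_self_eq_zero hσ'
      exact ⟨A, Subtype.ext ((add_zero _).symm.trans (congrArg _ hB0.symm))⟩)

/-! ### Finiteness and dimension counts -/

theorem finite_focalAdjointSections (hG : (cplx G).IsHomogeneous c)
    (h1 : coeff (Finsupp.single 2 c) (cplx G) = 1) (hadj : AdjointSequence c (cplx G)) :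
    Module.Finite ℂ (focalAdjointSections c (cplx G)) := by
  have hfin : Module.Finite ℂ (homogeneousSubmodule (Fin 3) ℂ (c - 2)) :=
    Module.Finite.iff_fg.2 (homogeneousSubmodule_fg _ _ (c - 2))
  have hle : focalAdjointSections c (cplx G) ≤
      (homogeneousSubmodule (Fin 3) ℂ (c - 2)).map (restrict (cplx G)).toLinearMap := by
    intro σ hσ
    obtain ⟨K, hK, rfl⟩ := exists_restrict_of_mem_focalAdjointSections hG h1 hadj hσ
    refine ⟨K, ?_, rfl⟩
    -- For c < 2 the truncated difference c - 2 is 0, but K = 0 since its integral degree is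
    -- negative.
    rcases lt_or_ge c 2 with h2 | h2
    · rw [hK.eq_zero_of_neg (by omega)]
      exact Submodule.zero_mem _
    · rwa [show (c : ℤ) - 2 = ((c - 2 : ℕ) : ℤ) by omega, homogeneousZ_natCast] at hK
  exact Submodule.finiteDimensional_of_le hle

theorem finite_zariskiTangent (htan : TangentSpaceDescription c W G) :
    Module.Finite ℝ (zariskiTangent W G) := by
  have hfin : Module.Finite ℝ (homogeneousSubmodule (Fin 3) ℝ c) :=
    Module.Finite.iff_fg.2 (homogeneousSubmodule_fg _ _ c)
  refine Submodule.finiteDimensional_of_le (S₂ := homogeneousSubmodule (Fin 3) ℝ c) fun H hH => ?_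
  exact IsHomogeneous.of_map (algebraMap ℝ ℂ).injective ((mem_zariskiTangent_iff htan).1 hH).1.1

/-- `H⁰(D̃, ℬ_D)` is the complexification of its real part. -/
theorem finrank_realFocalAdjointSections (hG : (cplx G).IsHomogeneous c)
    (h1 : coeff (Finsupp.single 2 c) (cplx G) = 1) (htan : TangentSpaceDescription c W G)
    (hadj : AdjointSequence c (cplx G))
    (hdisj : Disjoint (equiclassicalSupport c (cplx G)) isotropicLines) :
    Module.finrank ℝ (realFocalAdjointSections c G)
      = Module.finrank ℂ (focalAdjointSections c (cplx G)) := by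
  obtain ⟨t, ht⟩ := (isUnit_restrict_isotropicForm hG h1).exists_left_inv
  have := finite_zariskiTangent htan
  have : Module.Finite ℝ (realFocalAdjointSections c G) :=
    Module.Finite.equiv (kerFocalDifferentialEquiv hG h1 htan hadj hdisj ht)
  -- The map (x, y) ↦ x + iy identifies two copies of the real part with H⁰(ℬ_D) as a real space;
  -- halving the dimensions gives the claim.
  suffices h : Module.finrank ℝ (realFocalAdjointSections c G × realFocalAdjointSections c G)
      = 2 * Module.finrank ℂ (focalAdjointSections c (cplx G)) by
    rw [Module.finrank_prod] at h
    omega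
  rw [← finrank_real_of_complex]
  let _ : Module ℝ (focalAdjointSections c (cplx G)) := Module.complexToReal _
  let L : realFocalAdjointSections c G × realFocalAdjointSections c G →ₗ[ℝ]
      focalAdjointSections c (cplx G) :=
    { toFun p := ⟨p.1.1 + Complex.I • p.2.1,
        Submodule.add_mem _ p.1.2.1 (Submodule.smul_mem _ _ p.2.2.1)⟩
      map_add' p p' := Subtype.ext (by
        change (p.1.1 + p'.1.1) + Complex.I • (p.2.1 + p'.2.1)
          = (p.1.1 + Complex.I • p.2.1) + (p'.1.1 + Complex.I • p'.2.1)
        rw [smul_add]; abel)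
      map_smul' r p := Subtype.ext (by
        change r • p.1.1 + Complex.I • r • p.2.1 = (r : ℂ) • (p.1.1 + Complex.I • p.2.1)
        rw [real_smul_eq, real_smul_eq, smul_add, smul_comm (r : ℂ)]) }
  refine (LinearEquiv.ofBijective L ⟨?_, ?_⟩).finrank_eq
  · rw [injective_iff_map_eq_zero]
    rintro ⟨x, y⟩ h
    obtain ⟨hx, hy⟩ := eq_zero_of_add_I_smul_eq_zero x.2.2 y.2.2 (congrArg Subtype.val h)
    exact Prod.ext (Subtype.ext hx) (Subtype.ext hy)
  · rintro ⟨σ, hσ⟩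
    obtain ⟨A, B, rfl⟩ := exists_eq_divIsotropicForm_add_I_smul hG h1 htan hadj hdisj ht hσ
    exact ⟨⟨⟨_, divIsotropicForm_mem hG h1 htan hadj hdisj ht A⟩,
      ⟨_, divIsotropicForm_mem hG h1 htan hadj hdisj ht B⟩⟩, rfl⟩

end

end FocalCurves
end

/-! ### The main theorem -/

theorem mainTheorem2 (c d : ℕ) (g : ℤ)
    (W : Set (MvPolynomial (Fin 3) ℝ))
    (hW : FocalCurves.IsComponent W (FocalCurves.realEquiclassicalFamily c g d))
    (G : MvPolynomial (Fin 3) ℝ) (hG : FocalCurves.IsSmoothPoint W G)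
    (htan : FocalCurves.TangentSpaceDescription c W G)
    (hadj : FocalCurves.AdjointSequence c (FocalCurves.cplx G))
    (hdisj : Disjoint (FocalCurves.equiclassicalSupport c (FocalCurves.cplx G))
      FocalCurves.isotropicLines) :
    (∃! e : LinearMap.ker (FocalCurves.focalDifferential W G) ≃ₗ[ℝ]
          FocalCurves.realFocalAdjointSections c G,
        ∀ H : LinearMap.ker (FocalCurves.focalDifferential W G),
          FocalCurves.restrict (FocalCurves.cplx G) (FocalCurves.cplx H.1.1) =
            FocalCurves.restrict (FocalCurves.cplx G) FocalCurves.isotropicForm *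
              (e H : FocalCurves.RatRing (FocalCurves.cplx G))) ∧
      Module.Finite ℂ (FocalCurves.focalAdjointSections c (FocalCurves.cplx G)) ∧
      Module.finrank ℝ (LinearMap.ker (FocalCurves.focalDifferential W G)) =
        Module.finrank ℂ (FocalCurves.focalAdjointSections c (FocalCurves.cplx G)) ∧
      (∀ n : ℕ, FocalCurves.zariskiDim W = n → (n : ℤ) = c + d - g + 1 →
        (Module.finrank ℝ (LinearMap.range (FocalCurves.focalDifferential W G)) : ℤ) =
          c + d - g + 1 -
            Module.finrank ℂ (FocalCurves.focalAdjointSections c (FocalCurves.cplx G))) := by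
  obtain ⟨hGc, h1, -⟩ := hW.prop.1 hG.1
  have hu := FocalCurves.isUnit_restrict_isotropicForm hGc h1
  obtain ⟨t, ht⟩ := hu.exists_left_inv
  let e := FocalCurves.kerFocalDifferentialEquiv hGc h1 htan hadj hdisj ht
  have he := FocalCurves.restrict_cplx_eq_mul_divIsotropicForm (W := W) ht
  have hker : Module.finrank ℝ (LinearMap.ker (FocalCurves.focalDifferential W G)) =
      Module.finrank ℂ (FocalCurves.focalAdjointSections c (FocalCurves.cplx G)) :=
    e.finrank_eq.trans (FocalCurves.finrank_realFocalAdjointSections hGc h1 htan hadj hdisj)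
  refine ⟨⟨e, he, fun e' he' => ?_⟩, FocalCurves.finite_focalAdjointSections hGc h1 hadj, hker,
    fun n hn hexp => ?_⟩
  -- Uniqueness: u²+v² is invertible on D, so the relation determines σ.
  · refine LinearEquiv.ext fun H => Subtype.ext (hu.mul_left_cancel ?_)
    exact (he' H).symm.trans (he H)
  · have := FocalCurves.finite_zariskiTangent htan
    have hrank := LinearMap.finrank_range_add_finrank_ker (FocalCurves.focalDifferential W G)
    -- Smoothness of G turns the dimension of W into that of the tangent space, the source of the
    -- differential.
    have hdim : Module.finrank ℝ (FocalCurves.zariskiTangent W G) = n := by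
      exact_mod_cast hG.2.trans hn
    omega
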